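/- Let $n\ge 2$, and let $\phi=(f_1,\dots,f_n)^\tau:\mathbb{R}\to\mathbb{R}^n$ be a measurable function. Suppose that there is an open set $E\subseteq\mathbb{R}$ such that $f_1,\dots,f_n\in C^n(E)$ and $f_1,\dots,f_n$ are linearly independent on $E$. Suppose also that for some $b>0$ and some constants $K_1,K_2$, $$\|\phi(x)\|\le K_1+K_2|x|^b\qquad\text{for all }x\in\mathbb{R}.$$ Let $\sigma>0$ and $\theta_0\in\mathbb{R}^n$. On a probability space let $w_1,w_2,\dots$ be i.i.d. $N(0,\sigma^2)$ random variables, let $\theta\sim N(\theta_0,I_n)$ be a random vector independent of $\{w_t\}_{t\ge1}$, and let $y_0$ be a real random variable (for instance a constant) independent of $(\theta,\{w_t\}_{t\ge1})$. Consider the closed-loop system defined, for $t\ge 0$ and with $\phi_t=\phi(y_t)$, $\hat\theta_0=\theta_0$, $P_0=I_n$, by $$u_t=-\hat\theta_t^\tau\phi_t,\qquad y_{t+1}=\theta^\tau\phi_t+u_t+w_{t+1},$$ $$P_{t+1}=P_t-(\sigma^2+\phi_t^\tau P_t\phi_t)^{-1}P_t\phi_t\phi_t^\tau P_t,\qquad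 \hat\theta_{t+1}=\hat\theta_t+\sigma^{-2}P_{t+1}\phi_t\,(y_{t+1}-u_t-\phi_t^\tau\hat\theta_t).$$ Let $\lambda_{\min}(t+1)$ denote the smallest eigenvalue of $P_{t+1}^{-1}$. All asymptotic relations below are pathwise, as $t\to+\infty$. Then there is an event $D$ with $P(D)=0$ such that $$\Big\{\sum_{i=1}^t y_i^2=O(t)\Big\}\setminus D\ \subseteq\ \Big\{\liminf_{t\to+\infty}\frac{\lambda_{\min}(t+1)}{t}>0\Big\}\cap\Big\{\lim_{t\to+\infty}\frac1t\sum_{i=1}^t y_i^2=\sigma^2\Big\},$$ and, almost surely, $$\sum_{i=1}^t y_i^2=O(t)\quad\text{implies}\quad \|\hat\theta_{t+1}-\theta\|^2=O\Big(\frac{\log t}{t}\Big).$$ -/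

import Mathlib

open MeasureTheory ProbabilityTheory Filter Topology Asymptotics Set
open scoped RealInnerProductSpace Matrix

/-- The smallest eigenvalue of a real square matrix (used for symmetric matrices of positive size,
whose set of real eigenvalues is finite and nonempty). -/
noncomputable def minEigenvalue {n : ℕ} (A : Matrix (Fin n) (Fin n) ℝ) : ℝ :=
  sInf {r : ℝ | Module.End.HasEigenvalue (Matrix.toLin' A) r}

/-- The variables of the closed loop at a given time `t`: the output `y_t`, the least-squares
estimate `θ̂_t` and the matrix `P_t`. -/
structure LoopState (n : ℕ) where
  y : ℝ
  est : EuclideanSpace ℝ (Fin n)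
  P : Matrix (Fin n) (Fin n) ℝ

namespace LoopState

variable {n : ℕ}

/-- The certainty-equivalence control `u_t = -θ̂_tᵀ φ(y_t)`. -/
noncomputable def input (φ : ℝ → EuclideanSpace ℝ (Fin n)) (s : LoopState n) : ℝ :=
  -⟪s.est, φ s.y⟫

/-- The new output `y_{t+1} = θᵀ φ(y_t) + u_t + w_{t+1}`. -/
noncomputable def nextY (φ : ℝ → EuclideanSpace ℝ (Fin n)) (θ : EuclideanSpace ℝ (Fin n)) (w : ℝ)
    (s : LoopState n) : ℝ :=
  ⟪θ, φ s.y⟫ + s.input φ + w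

/-- `P_{t+1} = P_t - (σ² + φ_tᵀ P_t φ_t)⁻¹ P_t φ_t φ_tᵀ P_t`, where `φ_t = φ(y_t)`. -/
noncomputable def nextP (φ : ℝ → EuclideanSpace ℝ (Fin n)) (σ : ℝ) (s : LoopState n) :
    Matrix (Fin n) (Fin n) ℝ :=
  let v : Fin n → ℝ := (φ s.y).ofLp
  s.P - (σ ^ 2 + v ⬝ᵥ (s.P *ᵥ v))⁻¹ • (s.P * Matrix.vecMulVec v v * s.P)

/-- `θ̂_{t+1} = θ̂_t + σ⁻² P_{t+1} φ_t (y_{t+1} - u_t - φ_tᵀ θ̂_t)`, where `φ_t = φ(y_t)`. -/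
noncomputable def nextEst (φ : ℝ → EuclideanSpace ℝ (Fin n)) (σ : ℝ)
    (θ : EuclideanSpace ℝ (Fin n)) (w : ℝ) (s : LoopState n) : EuclideanSpace ℝ (Fin n) :=
  s.est + ((σ ^ 2)⁻¹ * (s.nextY φ θ w - s.input φ - ⟪φ s.y, s.est⟫)) •
    Matrix.toEuclideanLin (s.nextP φ σ) (φ s.y)

end LoopState

/-- The trajectory of the closed loop for one realization of the parameter `θ`, of the initial
output `y0` and of the noise sequence `w` (only `w 1, w 2, …` enter), started at `θ̂_0 = θ0` and
`P_0 = I`. -/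
noncomputable def closedLoop {n : ℕ} (φ : ℝ → EuclideanSpace ℝ (Fin n)) (σ : ℝ)
    (θ0 θ : EuclideanSpace ℝ (Fin n)) (y0 : ℝ) (w : ℕ → ℝ) : ℕ → LoopState n
  | 0 => ⟨y0, θ0, 1⟩
  | t + 1 =>
    let s := closedLoop φ σ θ0 θ y0 w t
    ⟨s.nextY φ θ (w (t + 1)), s.nextEst φ σ θ (w (t + 1)), s.nextP φ σ⟩

/-!
With a Gaussian prior and Gaussian noise the least-squares recursion is the Kalman filter: given
`y_0, …, y_t`, the parameter `θ` has law `N(θ̂_t, P_t)`. Hence `y_{t+1} = s_t e_t`, where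
`s_t² = σ² + φ_tᵀ P_t φ_t` is a function of the past outputs and the innovations `e_t` are i.i.d.
`N(0, 1)`, and `P_t^{-1/2} (θ - θ̂_t)` is a standard Gaussian vector at every time `t`.

To avoid conditional laws and matrix square roots, `P_t` is factored as `A_t A_tᵀ` by the explicit
recursion `A_{t+1} = A_t (1 - κ v vᵀ)`, `v = A_tᵀ φ_t`, and `θ - θ̂_t = A_t z_t`
(`closedLoop_eq_factorLoop`). In these variables one step of the loop is a linear isometry, chosen
by the past, that turns `(z_t, w_{t+1} / σ)` into `(z_{t+1}, e_t)`. It preserves the Gaussian law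
(`map_innovRotation`), so `z_{t+1}` and `e_t` are independent standard Gaussian and independent of
the past (`IsInnovationSystem.map_S_z`, `IsInnovationSystem.map_S_e`).

Three almost sure facts follow. By Fernique's theorem and the Borel–Cantelli lemma, `e_t²` and
`‖z_t‖²` are `O(log t)`. By the strong law, `t⁻¹ ∑ e_i² → 1`. By an exponential supermartingale,
events of conditional probability at least `p` on a predictable set of times occur at a fraction at
least `p / 2` of these times, up to a logarithmic error
(`IsInnovationSystem.ae_eventually_card_le`).

The rest is pathwise. If `∑ y_i² = O(t)`, the scales `s_t` are bounded for at least half of the time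
(`exists_eventually_half_le_card`). At such times the output falls in any given interval with
probability bounded below, and finitely many intervals in `E` detect all directions because the
`f_j` are continuous and linearly independent there (`exists_finset_Ioo_le_abs_inner`); so
`P_t⁻¹ = 1 + σ⁻² ∑ φ_i φ_iᵀ` grows linearly (`exists_eventually_le_infoMatrix`). Then
`s_t² - σ² ≤ ‖φ(y_t)‖² / (c t)`, and since `φ` grows polynomially, a single late time with `s_t`
bounded forces `s_t → σ` (`tendsto_scale_sq`), whence the limit of `t⁻¹ ∑ y_i²`. Finally
`c t ‖θ - θ̂_t‖² ≤ ‖z_t‖² = O(log t)`.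
-/

/-! ### Innovations of a randomly rotated Gaussian system -/

section Innovations

variable {Ω 𝒮 Z : Type*} {mΩ : MeasurableSpace Ω} [MeasurableSpace 𝒮] [MeasurableSpace Z]

/-- A state `S t` and a hidden variable `z t` driven by a noise `η t`. At every step the pair
`(z t, η t)` is sent by the map `R (S t)`, which preserves the law `γ ⊗ ν`, to the new hidden
variable and to the innovation `e t`; the new state is a function of the old one and of `e t`.
The σ-algebra `m t` describes what is known before the noise `η t`, which is independent of it. -/
structure IsInnovationSystem (μ : Measure Ω) (γ : Measure Z) (ν : Measure ℝ)
    (m : ℕ → MeasurableSpace Ω) (F : ℕ → 𝒮 → ℝ → 𝒮) (R : 𝒮 → Z × ℝ → Z × ℝ)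
    (S : ℕ → Ω → 𝒮) (z : ℕ → Ω → Z) (η e : ℕ → Ω → ℝ) : Prop where
  measurable_F : ∀ t, Measurable (Function.uncurry (F t))
  measurable_R : Measurable (Function.uncurry R)
  map_R : ∀ s, (γ.prod ν).map (R s) = γ.prod ν
  le : ∀ t, m t ≤ mΩ
  mono : ∀ t, m t ≤ m (t + 1)
  measurable_S_zero : Measurable[m 0] (S 0)
  measurable_z_zero : Measurable[m 0] (z 0)
  measurable_noise : ∀ t, Measurable[m (t + 1)] (η t)
  indep_noise : ∀ t, Indep (m t) (MeasurableSpace.comap (η t) inferInstance) μ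
  map_noise : ∀ t, μ.map (η t) = ν
  indep_zero : IndepFun (S 0) (z 0) μ
  map_z_zero : μ.map (z 0) = γ
  rotate : ∀ t ω, (z (t + 1) ω, e t ω) = R (S t ω) (z t ω, η t ω)
  step : ∀ t ω, S (t + 1) ω = F t (S t ω) (e t ω)

namespace IsInnovationSystem

variable {μ : Measure Ω} {γ : Measure Z} {ν : Measure ℝ} {m : ℕ → MeasurableSpace Ω}
  {F : ℕ → 𝒮 → ℝ → 𝒮} {R : 𝒮 → Z × ℝ → Z × ℝ} {S : ℕ → Ω → 𝒮} {z : ℕ → Ω → Z} {η e : ℕ → Ω → ℝ}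

lemma measurable_known (h : IsInnovationSystem μ γ ν m F R S z η e) (t : ℕ) :
    Measurable[m t] (S t) ∧ Measurable[m t] (z t) ∧ Measurable[m (t + 1)] (e t) := by
  have key : ∀ t, Measurable[m t] (S t) → Measurable[m t] (z t) →
      Measurable[m (t + 1)] (fun ω => (z (t + 1) ω, e t ω)) := by
    intro t hS hz
    have h1 : Measurable[m (t + 1)] (fun ω => (S t ω, (z t ω, η t ω))) :=
      (hS.mono (h.mono t) le_rfl).prodMk
        ((hz.mono (h.mono t) le_rfl).prodMk (h.measurable_noise t))
    have h2 := h.measurable_R.comp h1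
    exact (funext fun ω => (h.rotate t ω).symm : _ = fun ω => (z (t + 1) ω, e t ω)) ▸ h2
  induction t with
  | zero =>
    exact ⟨h.measurable_S_zero, h.measurable_z_zero,
      measurable_snd.comp (key 0 h.measurable_S_zero h.measurable_z_zero)⟩
  | succ t ih =>
    have hz : Measurable[m (t + 1)] (z (t + 1)) := measurable_fst.comp (key t ih.1 ih.2.1)
    have hS : Measurable[m (t + 1)] (S (t + 1)) := by
      have h1 : Measurable[m (t + 1)] (fun ω => (S t ω, e t ω)) :=
        (ih.1.mono (h.mono t) le_rfl).prodMk ih.2.2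
      exact (funext fun ω => (h.step t ω).symm : _ = S (t + 1)) ▸ (h.measurable_F t).comp h1
    exact ⟨hS, hz, measurable_snd.comp (key (t + 1) hS hz)⟩

lemma measurable_S (h : IsInnovationSystem μ γ ν m F R S z η e) (t : ℕ) : Measurable (S t) :=
  (h.measurable_known t).1.mono (h.le t) le_rfl

lemma measurable_z (h : IsInnovationSystem μ γ ν m F R S z η e) (t : ℕ) : Measurable (z t) :=
  (h.measurable_known t).2.1.mono (h.le t) le_rfl

lemma measurable_e (h : IsInnovationSystem μ γ ν m F R S z η e) (t : ℕ) : Measurable (e t) :=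
  (h.measurable_known t).2.2.mono (h.le _) le_rfl

/-- One step of the system: a measure-preserving map chosen independently of its argument. -/
lemma map_S_rotate [IsProbabilityMeasure μ] [IsProbabilityMeasure γ] [IsProbabilityMeasure ν]
    (h : IsInnovationSystem μ γ ν m F R S z η e) {t : ℕ}
    (ht : μ.map (fun ω => (S t ω, z t ω)) = (μ.map (S t)).prod γ) :
    μ.map (fun ω => (S t ω, (z (t + 1) ω, e t ω))) = (μ.map (S t)).prod (γ.prod ν) := by
  have hS := h.measurable_S t
  have hz := h.measurable_z t
  have hη : Measurable (η t) := (h.measurable_noise t).mono (h.le _) le_rfl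
  have hi : IndepFun (fun ω => (S t ω, z t ω)) (η t) μ := by
    rw [IndepFun_iff_Indep]
    exact indep_of_indep_of_le_left (h.indep_noise t)
      ((h.measurable_known t).1.prodMk (h.measurable_known t).2.1).comap_le
  have h1 := hi.map_prod_eq_prod_map_map (hS.prodMk hz).aemeasurable hη.aemeasurable
  rw [ht, h.map_noise] at h1
  have h2 : μ.map (fun ω => (S t ω, (z t ω, η t ω))) = (μ.map (S t)).prod (γ.prod ν) := by
    rw [← (measurePreserving_prodAssoc (μ.map (S t)) γ ν).map_eq, ← h1,
      Measure.map_map (by fun_prop) (by fun_prop)]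
    rfl
  have : IsProbabilityMeasure (μ.map (S t)) := Measure.isProbabilityMeasure_map hS.aemeasurable
  have h3 := ((MeasurePreserving.id (μ.map (S t))).skew_product h.measurable_R
    (ae_of_all _ h.map_R)).map_eq
  rw [← h2, Measure.map_map (by have := h.measurable_R; exact measurable_fst.prodMk this)
    (by fun_prop)] at h3
  rw [← h2, ← h3]
  congr 1
  funext ω
  simp [h.rotate]

/-- The hidden variable keeps its law and stays independent of the state. -/
lemma map_S_z [IsProbabilityMeasure μ] [IsProbabilityMeasure γ] [IsProbabilityMeasure ν]
    (h : IsInnovationSystem μ γ ν m F R S z η e) (t : ℕ) :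
    μ.map (fun ω => (S t ω, z t ω)) = (μ.map (S t)).prod γ := by
  induction t with
  | zero =>
    rw [h.indep_zero.map_prod_eq_prod_map_map (h.measurable_S 0).aemeasurable
      (h.measurable_z 0).aemeasurable, h.map_z_zero]
  | succ t ih =>
    have h1 := h.map_S_rotate ih
    have hS := h.measurable_S t
    have hz := h.measurable_z (t + 1)
    have he := h.measurable_e t
    have hF := h.measurable_F t
    have : IsProbabilityMeasure (μ.map (S t)) := Measure.isProbabilityMeasure_map hS.aemeasurable
    -- regroup so that the pair (state, innovation), which determines the new state, comes first
    have h2 : μ.map (fun ω => ((S t ω, e t ω), z (t + 1) ω)) = ((μ.map (S t)).prod ν).prod γ := by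
      rw [← ((measurePreserving_prodAssoc (μ.map (S t)) ν γ).symm _).map_eq,
        ← ((MeasurePreserving.id (μ.map (S t))).prod
          (Measure.measurePreserving_swap (μ := γ) (ν := ν))).map_eq, ← h1,
        Measure.map_map (by fun_prop) (by fun_prop), Measure.map_map (by fun_prop) (by fun_prop)]
      rfl
    have h3 : μ.map (fun ω => (S (t + 1) ω, z (t + 1) ω)) =
        (((μ.map (S t)).prod ν).map (Function.uncurry (F t))).prod γ := by
      conv_rhs => rw [← Measure.map_id (μ := γ)]
      rw [Measure.map_prod_map _ _ hF measurable_id, ← h2,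
        Measure.map_map (by fun_prop) (by fun_prop)]
      congr 1
      funext ω
      simp [h.step]
    have h4 := congrArg (Measure.map Prod.fst) h3
    have : IsProbabilityMeasure (((μ.map (S t)).prod ν).map (Function.uncurry (F t))) :=
      Measure.isProbabilityMeasure_map hF.aemeasurable
    rw [Measure.map_map (by fun_prop) ((h.measurable_S (t + 1)).prodMk hz), Measure.map_fst_prod]
      at h4
    have h5 : μ.map (S (t + 1)) = ((μ.map (S t)).prod ν).map (Function.uncurry (F t)) := by
      simpa [Function.comp_def] using h4
    rw [h3, h5]

lemma map_S_e [IsProbabilityMeasure μ] [IsProbabilityMeasure γ] [IsProbabilityMeasure ν]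
    (h : IsInnovationSystem μ γ ν m F R S z η e) (t : ℕ) :
    μ.map (fun ω => (S t ω, e t ω)) = (μ.map (S t)).prod ν := by
  have h1 := h.map_S_rotate (h.map_S_z t)
  have hS := h.measurable_S t
  have hz := h.measurable_z (t + 1)
  have he := h.measurable_e t
  have : IsProbabilityMeasure (μ.map (S t)) := Measure.isProbabilityMeasure_map hS.aemeasurable
  have h2 := congrArg (Measure.map (Prod.map id Prod.snd)) h1
  rw [Measure.map_map (by fun_prop) (by fun_prop),
    ← Measure.map_prod_map _ _ measurable_id measurable_snd, Measure.map_snd_prod] at h2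
  simpa [Function.comp_def] using h2

lemma map_z [IsProbabilityMeasure μ] [IsProbabilityMeasure γ] [IsProbabilityMeasure ν]
    (h : IsInnovationSystem μ γ ν m F R S z η e) (t : ℕ) : μ.map (z t) = γ := by
  have hS := h.measurable_S t
  have hz := h.measurable_z t
  have : IsProbabilityMeasure (μ.map (S t)) := Measure.isProbabilityMeasure_map hS.aemeasurable
  have h2 := congrArg (Measure.map Prod.snd) (h.map_S_z t)
  rw [Measure.map_map (by fun_prop) (by fun_prop), Measure.map_snd_prod] at h2
  simpa [Function.comp_def] using h2

lemma map_e [IsProbabilityMeasure μ] [IsProbabilityMeasure γ] [IsProbabilityMeasure ν]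
    (h : IsInnovationSystem μ γ ν m F R S z η e) (t : ℕ) : μ.map (e t) = ν := by
  have hS := h.measurable_S t
  have he := h.measurable_e t
  have : IsProbabilityMeasure (μ.map (S t)) := Measure.isProbabilityMeasure_map hS.aemeasurable
  have h2 := congrArg (Measure.map Prod.snd) (h.map_S_e t)
  rw [Measure.map_map (by fun_prop) (by fun_prop), Measure.map_snd_prod] at h2
  simpa [Function.comp_def] using h2

lemma indepFun_S_e [IsProbabilityMeasure μ] [IsProbabilityMeasure γ] [IsProbabilityMeasure ν]
    (h : IsInnovationSystem μ γ ν m F R S z η e) (t : ℕ) : IndepFun (S t) (e t) μ := by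
  rw [indepFun_iff_map_prod_eq_prod_map_map (h.measurable_S t).aemeasurable
    (h.measurable_e t).aemeasurable, h.map_S_e, h.map_e]

/-- An accumulator `T` updated from the state and the innovation can be adjoined to the state. -/
lemma prodMk {𝒯 : Type*} [MeasurableSpace 𝒯] (h : IsInnovationSystem μ γ ν m F R S z η e)
    {G : ℕ → 𝒮 × 𝒯 → ℝ → 𝒯} (hG : ∀ t, Measurable (Function.uncurry (G t))) {T : ℕ → Ω → 𝒯}
    {c : 𝒯} (hT0 : ∀ ω, T 0 ω = c) (hT : ∀ t ω, T (t + 1) ω = G t (S t ω, T t ω) (e t ω)) :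
    IsInnovationSystem μ γ ν m (fun t p x => (F t p.1 x, G t p x)) (fun p => R p.1)
      (fun t ω => (S t ω, T t ω)) z η e where
  measurable_F t := by
    have h1 : Measurable fun p : (𝒮 × 𝒯) × ℝ => Function.uncurry (F t) (p.1.1, p.2) :=
      (h.measurable_F t).comp (by fun_prop)
    exact h1.prodMk (hG t)
  measurable_R := by
    have h1 : Measurable fun p : (𝒮 × 𝒯) × (Z × ℝ) => Function.uncurry R (p.1.1, p.2) :=
      h.measurable_R.comp (by fun_prop)
    exact h1
  map_R p := h.map_R p.1
  le := h.le
  mono := h.mono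
  measurable_S_zero := by
    refine h.measurable_S_zero.prodMk ?_
    rw [show T 0 = fun _ => c from funext hT0]
    exact measurable_const
  measurable_z_zero := h.measurable_z_zero
  measurable_noise := h.measurable_noise
  indep_noise := h.indep_noise
  map_noise := h.map_noise
  indep_zero := by
    simp only [hT0]
    exact h.indep_zero.comp (φ := fun s => (s, c)) (ψ := id) (by fun_prop) measurable_id
  map_z_zero := h.map_z_zero
  rotate := h.rotate
  step t ω := by simp [h.step, hT]

lemma pairwise_indepFun [IsProbabilityMeasure μ] [IsProbabilityMeasure γ] [IsProbabilityMeasure ν]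
    (h : IsInnovationSystem μ γ ν m F R S z η e) :
    Pairwise (Function.onFun (fun X Y => IndepFun X Y μ) e) := by
  have key : ∀ i j, i < j → IndepFun (e i) (e j) μ := by
    intro i j hij
    -- the accumulator is the record of the innovations seen so far
    have h1 := h.prodMk (G := fun t p x => Function.update p.2 t x) (c := (0 : ℕ → ℝ))
      (T := fun t ω k => if k < t then e k ω else 0)
      (fun t => by
        refine measurable_pi_lambda _ fun k => ?_
        by_cases hk : k = t
        · subst hk; simpa [Function.uncurry] using measurable_snd
        · simp only [Function.uncurry, Function.update_of_ne hk]; fun_prop)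
      (fun ω => by funext k; simp)
      (fun t ω => by
        funext k
        by_cases hk : k = t
        · subst hk; simp
        · have : k < t + 1 ↔ k < t := by omega
          simp [Function.update_of_ne hk, this])
    have h2 := (h1.indepFun_S_e j).comp (φ := fun p => p.2 i) (ψ := id) (by fun_prop) measurable_id
    simpa [Function.comp_def, hij] using h2
  intro i j hij
  rcases lt_or_gt_of_ne hij with h1 | h1
  · exact key i j h1
  · exact (key j i h1).symm

/-- A product of nonnegative factors, each of conditional mean at most one given the state,
has mean at most one. -/
lemma lintegral_prod_le_one [IsProbabilityMeasure μ] [IsProbabilityMeasure γ]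
    [IsProbabilityMeasure ν] (h : IsInnovationSystem μ γ ν m F R S z η e)
    {g : 𝒮 × ℝ → ENNReal} (hg : Measurable g) (hg1 : ∀ s, ∫⁻ x, g (s, x) ∂ν ≤ 1) (t : ℕ) :
    ∫⁻ ω, ∏ i ∈ Finset.range t, g (S i ω, e i ω) ∂μ ≤ 1 := by
  have h1 := h.prodMk (G := fun t p x => p.2 * g (p.1, x)) (c := (1 : ENNReal))
    (T := fun t ω => ∏ i ∈ Finset.range t, g (S i ω, e i ω))
    (fun t => by simp only [Function.uncurry_def]; fun_prop) (fun ω => by simp)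
    (fun t ω => by simp [Finset.prod_range_succ])
  induction t with
  | zero => simp
  | succ t ih =>
    have hST := h1.measurable_S t
    have he := h1.measurable_e t
    have hT := measurable_snd.comp hST
    have h2 : ∫⁻ ω, ∏ i ∈ Finset.range (t + 1), g (S i ω, e i ω) ∂μ =
        ∫⁻ p : (𝒮 × ENNReal) × ℝ, p.1.2 * g (p.1.1, p.2) ∂(μ.map (fun ω =>
          ((S t ω, ∏ i ∈ Finset.range t, g (S i ω, e i ω)), e t ω))) := by
      rw [lintegral_map (by fun_prop) (hST.prodMk he)]
      simp [Finset.prod_range_succ]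
    rw [h2, h1.map_S_e, lintegral_prod _ (by fun_prop)]
    calc _ ≤ ∫⁻ p : 𝒮 × ENNReal, p.2 ∂(μ.map fun ω =>
          (S t ω, ∏ i ∈ Finset.range t, g (S i ω, e i ω))) := by
          refine lintegral_mono fun p => ?_
          simp only
          rw [lintegral_const_mul _ (by fun_prop)]
          exact mul_le_of_le_one_right' (hg1 _)
      _ = ∫⁻ ω, ∏ i ∈ Finset.range t, g (S i ω, e i ω) ∂μ := by
          rw [lintegral_map (by fun_prop) hST]
      _ ≤ 1 := ih

end IsInnovationSystem

end Innovations

/-! ### Almost sure growth and counting estimates -/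

section Growth

variable {Ω : Type*} [MeasurableSpace Ω] {μ : Measure Ω}

/-- By Markov's inequality and the Borel–Cantelli lemma, nonnegative random variables with
bounded means are eventually at most `(t + 1) ^ 2`. -/
lemma ae_eventually_lt_sq_of_lintegral_le {W : ℕ → Ω → ENNReal} (hW : ∀ t, AEMeasurable (W t) μ)
    {C : ENNReal} (hC : C ≠ ⊤) (h : ∀ t, ∫⁻ ω, W t ω ∂μ ≤ C) :
    ∀ᵐ ω ∂μ, ∀ᶠ t : ℕ in atTop, W t ω < ENNReal.ofReal (((t : ℝ) + 1) ^ 2) := by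
  have hpos : ∀ t : ℕ, (0 : ℝ) < ((t : ℝ) + 1) ^ 2 := fun t => by positivity
  have hle : ∀ t : ℕ, μ {ω | ENNReal.ofReal (((t : ℝ) + 1) ^ 2) ≤ W t ω} ≤
      C * ENNReal.ofReal ((((t : ℝ) + 1) ^ 2)⁻¹) := by
    intro t
    refine (meas_ge_le_lintegral_div (hW t) (ENNReal.ofReal_pos.2 (hpos t)).ne'
      ENNReal.ofReal_ne_top).trans ?_
    rw [ENNReal.ofReal_inv_of_pos (hpos t), div_eq_mul_inv]
    gcongr
    exact h t
  have hsum : Summable fun t : ℕ => (((t : ℝ) + 1) ^ 2)⁻¹ := by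
    have := (summable_nat_add_iff 1).2 (Real.summable_nat_pow_inv (p := 2).2 (by norm_num))
    simpa using this
  have h1 : ∑' t : ℕ, μ {ω | ENNReal.ofReal (((t : ℝ) + 1) ^ 2) ≤ W t ω} ≠ ⊤ := by
    refine ne_top_of_le_ne_top ?_ (ENNReal.tsum_le_tsum hle)
    rw [ENNReal.tsum_mul_left]
    exact ENNReal.mul_ne_top hC hsum.tsum_ofReal_ne_top
  filter_upwards [ae_eventually_notMem h1] with ω hω
  filter_upwards [hω] with t ht
  simpa using ht

/-- The squared norms of identically distributed Gaussian vectors, dependent or not, grow at most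
logarithmically; the exponential moment comes from Fernique's theorem. -/
lemma exists_ae_eventually_norm_sq_le_log {E : Type*} [NormedAddCommGroup E] [NormedSpace ℝ E]
    [MeasurableSpace E] [BorelSpace E] [SecondCountableTopology E] [CompleteSpace E]
    (γ : Measure E) [IsGaussian γ] :
    ∃ K : ℝ, 0 < K ∧ ∀ Z : ℕ → Ω → E, (∀ t, Measurable (Z t)) → (∀ t, μ.map (Z t) = γ) →
      ∀ᵐ ω ∂μ, ∀ᶠ t : ℕ in atTop, ‖Z t ω‖ ^ 2 ≤ K * Real.log (t + 1) := by
  obtain ⟨c, hc, hint⟩ := IsGaussian.exists_integrable_exp_sq γ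
  refine ⟨2 / c, by positivity, fun Z hZ hlaw => ?_⟩
  have h1 : ∀ t, ∫⁻ ω, ENNReal.ofReal (Real.exp (c * ‖Z t ω‖ ^ 2)) ∂μ =
      ∫⁻ x, ENNReal.ofReal (Real.exp (c * ‖x‖ ^ 2)) ∂γ := by
    intro t
    rw [← hlaw t, lintegral_map (by fun_prop) (hZ t)]
  have h2 := ae_eventually_lt_sq_of_lintegral_le (μ := μ)
    (W := fun t ω => ENNReal.ofReal (Real.exp (c * ‖Z t ω‖ ^ 2)))
    (fun t => by have := hZ t; fun_prop) hint.lintegral_lt_top.ne (fun t => (h1 t).le)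
  filter_upwards [h2] with ω hω
  filter_upwards [hω] with t ht
  have hp : (0 : ℝ) < (t : ℝ) + 1 := by positivity
  have h3 := (ENNReal.ofReal_lt_ofReal_iff (by positivity)).1 ht
  have h4 := (Real.log_lt_log (Real.exp_pos _) h3).le
  rw [Real.log_exp, Real.log_pow] at h4
  rw [div_mul_eq_mul_div, le_div_iff₀ hc]
  push_cast at h4
  linarith

open Classical in
/-- If, whenever the state lies in `K`, the innovation falls in `H` with conditional probability
at least `p`, then up to a logarithmic error the number of hits of `H` is at least `p / 2` times
the number of visits to `K`. Indeed `exp (p / 2 * visits - hits)` is a supermartingale. -/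
lemma IsInnovationSystem.ae_eventually_card_le {𝒮 Z : Type*} [MeasurableSpace 𝒮]
    [MeasurableSpace Z] {γ : Measure Z} {ν : Measure ℝ} {m : ℕ → MeasurableSpace Ω}
    {F : ℕ → 𝒮 → ℝ → 𝒮} {R : 𝒮 → Z × ℝ → Z × ℝ} {S : ℕ → Ω → 𝒮} {z : ℕ → Ω → Z}
    {η e : ℕ → Ω → ℝ} [IsProbabilityMeasure μ] [IsProbabilityMeasure γ] [IsProbabilityMeasure ν]
    (h : IsInnovationSystem μ γ ν m F R S z η e) {K : Set 𝒮} (hK : MeasurableSet K)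
    {H : Set (𝒮 × ℝ)} (hH : MeasurableSet H) {p : ℝ} (hp : 0 ≤ p)
    (hKH : ∀ s ∈ K, p ≤ ν.real {x | (s, x) ∈ H}) :
    ∀ᵐ ω ∂μ, ∀ᶠ t : ℕ in atTop,
      p / 2 * ((Finset.range t).filter fun i => S i ω ∈ K).card ≤
        ((Finset.range t).filter fun i => S i ω ∈ K ∧ (S i ω, e i ω) ∈ H).card +
          2 * Real.log (t + 1) := by
  set g : 𝒮 × ℝ → ℝ := fun q => (if q.1 ∈ K then p / 2 else 0) -
    (if q.1 ∈ K ∧ q ∈ H then 1 else 0) with hg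
  have hgm : Measurable g := by
    refine Measurable.sub ?_ ?_
    · exact Measurable.ite (measurable_fst hK) measurable_const measurable_const
    · exact Measurable.ite ((measurable_fst hK).inter hH) measurable_const measurable_const
  have hmean : ∀ s, ∫⁻ x, ENNReal.ofReal (Real.exp (g (s, x))) ∂ν ≤ 1 := by
    intro s
    by_cases hs : s ∈ K
    · have hHs : MeasurableSet {x | (s, x) ∈ H} := measurable_prodMk_left hH
      set q := ν.real {x | (s, x) ∈ H} with hq
      have hpt : ∀ x, Real.exp (g (s, x)) = Real.exp (p / 2) -
          (Real.exp (p / 2) * (1 - Real.exp (-1))) *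
            ({x | (s, x) ∈ H}.indicator (fun _ => (1 : ℝ)) x) := by
        intro x
        by_cases hx : (s, x) ∈ H
        · simp [hg, hs, hx, sub_eq_add_neg, Real.exp_add]; ring
        · simp [hg, hs, hx]
      have hi : Integrable (fun x => {x | (s, x) ∈ H}.indicator (fun _ => (1 : ℝ)) x) ν :=
        (integrable_const 1).indicator hHs
      have hint : Integrable (fun x => Real.exp (g (s, x))) ν := by
        simp_rw [hpt]
        exact (integrable_const _).sub (hi.const_mul _)
      rw [← ofReal_integral_eq_lintegral_ofReal hint (ae_of_all _ fun x => (Real.exp_pos _).le),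
        ENNReal.ofReal_le_one]
      simp_rw [hpt]
      rw [integral_sub (integrable_const _) (hi.const_mul _), integral_const_mul,
        integral_indicator_const _ hHs]
      simp only [integral_const, probReal_univ, smul_eq_mul, one_mul, mul_one]
      rw [← hq]
      have hqp : p ≤ q := hKH s hs
      have hq1 : q ≤ 1 := measureReal_le_one
      have he1 : Real.exp (-1) ≤ 1 / 2 := by
        have := Real.add_one_le_exp (1 : ℝ)
        rw [Real.exp_neg, ← one_div]
        exact one_div_le_one_div_of_le (by norm_num) (by linarith)
      -- `exp (p / 2) * (1 - p / 2) ≤ 1`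
      have he2 : Real.exp (p / 2) * (1 - p / 2) ≤ 1 := by
        have h1 := Real.add_one_le_exp (-(p / 2))
        calc Real.exp (p / 2) * (1 - p / 2) ≤ Real.exp (p / 2) * Real.exp (-(p / 2)) := by
              gcongr; linarith
          _ = 1 := by rw [← Real.exp_add]; simp
      have he3 : p / 2 ≤ (1 - Real.exp (-1)) * q := by nlinarith
      have := mul_le_mul_of_nonneg_left he3 (Real.exp_pos (p / 2)).le
      nlinarith
    · simp [hg, hs]
  have h1 := ae_eventually_lt_sq_of_lintegral_le (μ := μ)
    (W := fun t ω => ∏ i ∈ Finset.range t, ENNReal.ofReal (Real.exp (g (S i ω, e i ω))))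
    (fun t => by
      have h2 := fun i => h.measurable_S i
      have h3 := fun i => h.measurable_e i
      fun_prop) ENNReal.one_ne_top
    (fun t => h.lintegral_prod_le_one (g := fun q => ENNReal.ofReal (Real.exp (g q)))
      (by fun_prop) hmean t)
  filter_upwards [h1] with ω hω
  filter_upwards [hω] with t ht
  rw [← ENNReal.ofReal_prod_of_nonneg (fun i _ => (Real.exp_pos _).le), ← Real.exp_sum,
    ENNReal.ofReal_lt_ofReal_iff (by positivity)] at ht
  have h4 := (Real.log_lt_log (Real.exp_pos _) ht).le
  rw [Real.log_exp, Real.log_pow] at h4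
  simp only [hg, Finset.sum_sub_distrib] at h4
  rw [Finset.sum_boole, ← Finset.sum_filter, Finset.sum_const, nsmul_eq_mul] at h4
  push_cast at h4
  linarith

end Growth

/-! ### Gaussian facts -/

section Gaussian

/-- A standard Gaussian variable scaled by a factor in a compact subset of `(0, ∞)` hits a fixed
nonempty interval with probability bounded below. -/
lemma exists_pos_le_gaussianReal_mul_mem_Ioo {σ M a b : ℝ} (hσ : 0 < σ) (hab : a < b) :
    ∃ p : ℝ, 0 < p ∧ ∀ s, σ ≤ s → s ≤ M → p ≤ (gaussianReal 0 1).real {x | s * x ∈ Ioo a b} := by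
  by_cases hM : σ ≤ M
  swap
  · exact ⟨1, one_pos, fun s h1 h2 => absurd (h1.trans h2) hM⟩
  set L := (|a| + |b|) / σ with hL
  set d : ℝ := (√(2 * Real.pi * (1 : NNReal)))⁻¹ * Real.exp (-L ^ 2 / 2) with hd
  have hdpos : 0 < d := by have := Real.pi_pos; rw [hd]; positivity
  have hM0 : 0 < M := hσ.trans_le hM
  refine ⟨d * ((b - a) / M), by have := sub_pos.2 hab; positivity, fun s h1 h2 => ?_⟩
  have hs : 0 < s := hσ.trans_le h1
  have hset : {x | s * x ∈ Ioo a b} = Ioo (a / s) (b / s) := by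
    ext x
    simp only [mem_ofPred_eq, mem_Ioo, div_lt_iff₀ hs, lt_div_iff₀ hs, mul_comm s x]
  have hpdf : ∀ x ∈ Ioo (a / s) (b / s), d ≤ gaussianPDFReal 0 1 x := by
    intro x hx
    have hx1 : |x| ≤ L := by
      rw [← hset] at hx
      have hx2 : |s * x| ≤ |a| + |b| := by
        rw [abs_le]
        constructor
        · linarith [hx.1, neg_abs_le a, abs_nonneg b]
        · linarith [hx.2, le_abs_self b, abs_nonneg a]
      rw [abs_mul, abs_of_pos hs] at hx2
      rw [hL, le_div_iff₀ hσ]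
      nlinarith [abs_nonneg x]
    rw [gaussianPDFReal, hd]
    have : x ^ 2 ≤ L ^ 2 := sq_le_sq' (by linarith [neg_abs_le x]) (by linarith [le_abs_self x])
    refine mul_le_mul_of_nonneg_left (Real.exp_le_exp.2 ?_) (by positivity)
    simp only [NNReal.coe_one, mul_one, sub_zero]
    linarith
  rw [hset, measureReal_def, gaussianReal_apply _ one_ne_zero]
  have hlow : ENNReal.ofReal (d * ((b - a) / M)) ≤
      ∫⁻ x in Ioo (a / s) (b / s), gaussianPDF 0 1 x := by
    calc ENNReal.ofReal (d * ((b - a) / M)) ≤ ENNReal.ofReal (d * (b / s - a / s)) := by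
          apply ENNReal.ofReal_le_ofReal
          rw [← sub_div]
          have := (sub_pos.2 hab).le
          gcongr
      _ = ∫⁻ x in Ioo (a / s) (b / s), ENNReal.ofReal d := by
          rw [setLIntegral_const, Real.volume_Ioo, ENNReal.ofReal_mul hdpos.le]
      _ ≤ _ := by
          refine setLIntegral_mono' measurableSet_Ioo fun x hx => ?_
          exact ENNReal.ofReal_le_ofReal (hpdf x hx)
  rw [← gaussianReal_apply _ one_ne_zero] at hlow ⊢
  exact (ENNReal.ofReal_le_iff_le_toReal (measure_ne_top _ _)).1 hlow

variable {E : Type*} [NormedAddCommGroup E]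

/-- The standard deviation `√(σ² + ‖v‖²)` of `⟪v, z⟫ + w`, for `z` a standard Gaussian vector and
`w ∼ N(0, σ²)` independent of it. -/
noncomputable def innovScale (σ : ℝ) (v : E) : ℝ := √(σ ^ 2 + ‖v‖ ^ 2)

lemma innovScale_sq (σ : ℝ) (v : E) : innovScale σ v ^ 2 = σ ^ 2 + ‖v‖ ^ 2 :=
  Real.sq_sqrt (by positivity)

lemma le_innovScale (σ : ℝ) (v : E) : σ ≤ innovScale σ v :=
  Real.le_sqrt_of_sq_le (by nlinarith [norm_nonneg v])

/-- The coefficient `κ = 1 / (s (s + σ))`, `s = innovScale σ v`, for which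
`(1 - κ v vᵀ)² = 1 - s⁻² v vᵀ`. -/
noncomputable def rankOneCoeff (σ : ℝ) (v : E) : ℝ :=
  (innovScale σ v * (innovScale σ v + σ))⁻¹

lemma continuous_innovScale (σ : ℝ) : Continuous (innovScale σ : E → ℝ) := by
  unfold innovScale; fun_prop

lemma innovScale_pos {σ : ℝ} (hσ : 0 < σ) (v : E) : 0 < innovScale σ v :=
  hσ.trans_le (le_innovScale σ v)

lemma continuous_rankOneCoeff {σ : ℝ} (hσ : 0 < σ) : Continuous (rankOneCoeff σ : E → ℝ) := by
  unfold rankOneCoeff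
  have := continuous_innovScale (E := E) σ
  refine Continuous.inv₀ (by fun_prop) fun v => ?_
  have := innovScale_pos hσ v
  positivity

variable [InnerProductSpace ℝ E]

/-- The linear isometry of the Euclidean product `E × ℝ` that sends `(z, η)` to a pair whose
second component is the normalization of `⟪v, z⟫ + σ η`. -/
noncomputable def innovRotation (σ : ℝ) (v : E) (p : E × ℝ) : E × ℝ :=
  (p.1 - (rankOneCoeff σ v * ⟪v, p.1⟫ + p.2 / innovScale σ v) • v,
    (⟪v, p.1⟫ + σ * p.2) / innovScale σ v)

lemma continuous_innovRotation {σ : ℝ} (hσ : 0 < σ) :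
    Continuous (Function.uncurry (innovRotation σ : E → E × ℝ → E × ℝ)) := by
  have h1 := continuous_innovScale (E := E) σ
  have h2 := continuous_rankOneCoeff (E := E) hσ
  have h3 : ∀ p : E × E × ℝ, innovScale σ p.1 ≠ 0 := fun p => (innovScale_pos hσ p.1).ne'
  unfold Function.uncurry innovRotation
  have h4 : Continuous fun p : E × E × ℝ => p.2.2 / innovScale σ p.1 :=
    Continuous.div (by fun_prop) (by fun_prop) h3
  have h5 : Continuous fun p : E × E × ℝ =>
      (⟪p.1, p.2.1⟫ + σ * p.2.2) / innovScale σ p.1 :=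
    Continuous.div (by fun_prop) (by fun_prop) h3
  fun_prop

/-- The rotation preserves the standard Gaussian law: its transpose preserves the Euclidean norm,
and the characteristic function of the law depends on that norm only. -/
lemma map_innovRotation [FiniteDimensional ℝ E] [MeasurableSpace E] [BorelSpace E] {σ : ℝ}
    (hσ : 0 < σ) (v : E) :
    ((stdGaussian E).prod (gaussianReal 0 1)).map (innovRotation σ v) =
      (stdGaussian E).prod (gaussianReal 0 1) := by
  have hc : Continuous (innovRotation σ v) :=
    (continuous_innovRotation hσ).comp (by fun_prop : Continuous fun p : E × ℝ => (v, p))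
  set s := innovScale σ v with hs
  set κ := rankOneCoeff σ v with hκ
  have hspos : 0 < s := innovScale_pos hσ v
  have hv : ‖v‖ ^ 2 = s ^ 2 - σ ^ 2 := by rw [hs, innovScale_sq]; ring
  have hκ' : κ = (s * (s + σ))⁻¹ := rfl
  have hchar : ∀ x : E × ℝ, charFun (((stdGaussian E).prod (gaussianReal 0 1)).map
      (WithLp.toLp 2)) (WithLp.toLp 2 x) =
      Complex.exp (((-(‖x.1‖ ^ 2 + x.2 ^ 2) / 2 : ℝ) : ℂ)) := by
    intro x
    rw [charFun_prod, charFun_stdGaussian, charFun_gaussianReal, ← Complex.exp_add]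
    congr 1
    push_cast
    simp
    ring
  have hinj : MeasurableEmbedding (WithLp.toLp 2 : E × ℝ → WithLp 2 (E × ℝ)) :=
    (MeasurableEquiv.toLp 2 (E × ℝ)).measurableEmbedding
  have key : (((stdGaussian E).prod (gaussianReal 0 1)).map (innovRotation σ v)).map
      (WithLp.toLp 2) = ((stdGaussian E).prod (gaussianReal 0 1)).map (WithLp.toLp 2) := by
    have : IsProbabilityMeasure ((((stdGaussian E).prod (gaussianReal 0 1)).map
        (innovRotation σ v)).map (WithLp.toLp 2)) := by
      rw [Measure.map_map (by fun_prop) hc.measurable]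
      exact Measure.isProbabilityMeasure_map (by have := hc.measurable; fun_prop)
    have : IsProbabilityMeasure (((stdGaussian E).prod (gaussianReal 0 1)).map
        (WithLp.toLp 2)) := Measure.isProbabilityMeasure_map (by fun_prop)
    apply Measure.ext_of_charFun
    funext x
    -- the transposed rotation, applied to the dual variable `x`
    set x' : E × ℝ := (x.fst + (x.snd / s - κ * ⟪v, x.fst⟫) • v, (σ * x.snd - ⟪v, x.fst⟫) / s)
      with hx'
    have h1 : charFun ((((stdGaussian E).prod (gaussianReal 0 1)).map
        (innovRotation σ v)).map (WithLp.toLp 2)) x =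
        charFun (((stdGaussian E).prod (gaussianReal 0 1)).map (WithLp.toLp 2))
          (WithLp.toLp 2 x') := by
      rw [Measure.map_map (by fun_prop) hc.measurable, charFun_apply, charFun_apply,
        integral_map (by have := hc.measurable; fun_prop) (by fun_prop),
        integral_map (by fun_prop) (by fun_prop)]
      congr 1
      funext p
      congr 3
      simp only [Function.comp, WithLp.prod_inner_apply, innovRotation, hx', ← hs, ← hκ,
        inner_sub_left, inner_add_right, real_inner_smul_left, real_inner_smul_right]
      simp only [show x.ofLp.1 = x.fst from rfl, show x.ofLp.2 = x.snd from rfl,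
        real_inner_comm, RCLike.inner_apply, conj_trivial]
      field_simp
      ring
    rw [h1, hchar, show x = WithLp.toLp 2 (x.fst, x.snd) from rfl, hchar]
    congr 4
    simp only [hx', norm_add_sq_real, norm_smul, real_inner_smul_right, mul_pow,
      Real.norm_eq_abs, sq_abs, hv, hκ']
    rw [real_inner_comm]
    have : s + σ ≠ 0 := by positivity
    field_simp
    ring
  exact hinj.map_injective key

end Gaussian

/-! ### A square root of the matrix `P` along the closed loop -/

section Factor

variable {n : ℕ}

/-- The entrywise measurable structure on real matrices, which is the Borel one. -/
instance Matrix.instMeasurableSpaceReal : MeasurableSpace (Matrix (Fin n) (Fin n) ℝ) :=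
  inferInstanceAs (MeasurableSpace (Fin n → Fin n → ℝ))

instance Matrix.instBorelSpaceReal : BorelSpace (Matrix (Fin n) (Fin n) ℝ) :=
  inferInstanceAs (BorelSpace (Fin n → Fin n → ℝ))

instance Matrix.instSecondCountableTopologyReal :
    SecondCountableTopology (Matrix (Fin n) (Fin n) ℝ) :=
  inferInstanceAs (SecondCountableTopology (Fin n → Fin n → ℝ))

/-- The vector `Aᵀ φ(y)`, for a state consisting of the output `y` and of a factor `A` of
`P = A Aᵀ`. -/
noncomputable def whitenedRegressor (φ : ℝ → EuclideanSpace ℝ (Fin n))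
    (S : ℝ × Matrix (Fin n) (Fin n) ℝ) : EuclideanSpace ℝ (Fin n) :=
  WithLp.toLp 2 (S.2ᵀ *ᵥ (φ S.1).ofLp)

/-- One step of the output and of the factor: `y' = s e` and `A' = A (1 - κ v vᵀ)`, for
`v = Aᵀ φ(y)` and a normalized innovation `e`. -/
noncomputable def factorStep (φ : ℝ → EuclideanSpace ℝ (Fin n)) (σ : ℝ)
    (S : ℝ × Matrix (Fin n) (Fin n) ℝ) (e : ℝ) : ℝ × Matrix (Fin n) (Fin n) ℝ :=
  let v := whitenedRegressor φ S
  (innovScale σ v * e, S.2 - rankOneCoeff σ v • (S.2 * Matrix.vecMulVec v.ofLp v.ofLp))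

/-- The closed loop in the variables `((y, A), z)`, where `P = A Aᵀ` and `θ - θ̂ = A z`. -/
noncomputable def factorLoop (φ : ℝ → EuclideanSpace ℝ (Fin n)) (σ : ℝ)
    (θ0 θ : EuclideanSpace ℝ (Fin n)) (y0 : ℝ) (w : ℕ → ℝ) :
    ℕ → (ℝ × Matrix (Fin n) (Fin n) ℝ) × EuclideanSpace ℝ (Fin n)
  | 0 => ((y0, 1), θ - θ0)
  | t + 1 =>
    let q := factorLoop φ σ θ0 θ y0 w t
    let r := innovRotation σ (whitenedRegressor φ q.1) (q.2, w (t + 1) / σ)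
    (factorStep φ σ q.1 r.2, r.1)

lemma inner_eq_dotProduct (x y : EuclideanSpace ℝ (Fin n)) : ⟪x, y⟫ = x.ofLp ⬝ᵥ y.ofLp := by
  simp [PiLp.inner_apply, dotProduct, mul_comm]

lemma norm_sq_eq_dotProduct (x : EuclideanSpace ℝ (Fin n)) : ‖x‖ ^ 2 = x.ofLp ⬝ᵥ x.ofLp := by
  rw [← inner_eq_dotProduct, real_inner_self_eq_norm_sq]

lemma inner_mulVec_eq (A : Matrix (Fin n) (Fin n) ℝ) (z u : EuclideanSpace ℝ (Fin n)) :
    ⟪WithLp.toLp 2 (A *ᵥ z.ofLp), u⟫ = ⟪WithLp.toLp 2 (Aᵀ *ᵥ u.ofLp), z⟫ := by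
  simp only [inner_eq_dotProduct]
  rw [Matrix.mulVec_transpose, ← Matrix.dotProduct_mulVec, dotProduct_comm]

lemma rankOneCoeff_mul_norm_sq {σ : ℝ} (hσ : 0 < σ) (v : EuclideanSpace ℝ (Fin n)) :
    1 - rankOneCoeff σ v * ‖v‖ ^ 2 = σ / innovScale σ v := by
  have hs := innovScale_pos hσ v
  have hv : ‖v‖ ^ 2 = innovScale σ v ^ 2 - σ ^ 2 := by rw [innovScale_sq]; ring
  rw [hv, rankOneCoeff]
  have : innovScale σ v + σ ≠ 0 := by positivity
  field_simp
  ring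

/-- `(1 - κ v vᵀ) z' = z - (e / s) v`, for `(z', e)` the rotated pair. -/
lemma innovRotation_fst_sub {σ : ℝ} (hσ : 0 < σ) (v z : EuclideanSpace ℝ (Fin n)) (η : ℝ) :
    (innovRotation σ v (z, η)).1 -
        (rankOneCoeff σ v * ⟪v, (innovRotation σ v (z, η)).1⟫) • v =
      z - ((innovRotation σ v (z, η)).2 / innovScale σ v) • v := by
  have hs := innovScale_pos hσ v
  have hv : ‖v‖ ^ 2 = innovScale σ v ^ 2 - σ ^ 2 := by rw [innovScale_sq]; ring
  simp only [innovRotation, inner_sub_right, real_inner_smul_right, real_inner_self_eq_norm_sq]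
  rw [sub_sub, ← add_smul]
  congr 2
  rw [hv, rankOneCoeff]
  have : innovScale σ v + σ ≠ 0 := by positivity
  field_simp
  ring

lemma factor_mulVec (A : Matrix (Fin n) (Fin n) ℝ) (κ : ℝ) (v x : Fin n → ℝ) :
    (A - κ • (A * Matrix.vecMulVec v v)) *ᵥ x = A *ᵥ (x - (κ * (v ⬝ᵥ x)) • v) := by
  rw [Matrix.sub_mulVec, Matrix.smul_mulVec, ← Matrix.mulVec_mulVec, Matrix.vecMulVec_mulVec,
    Matrix.mulVec_sub, Matrix.mulVec_smul]
  simp [Matrix.mulVec_smul, smul_smul]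

/-- The recursion for `P`, read on the factor; the innovation `e` does not affect the latter. -/
lemma nextP_eq {φ : ℝ → EuclideanSpace ℝ (Fin n)} {σ : ℝ} (hσ : 0 < σ) (y : ℝ)
    (est : EuclideanSpace ℝ (Fin n)) (A : Matrix (Fin n) (Fin n) ℝ) (e : ℝ) :
    (LoopState.mk y est (A * Aᵀ)).nextP φ σ =
      (factorStep φ σ (y, A) e).2 * (factorStep φ σ (y, A) e).2ᵀ := by
  set v := whitenedRegressor φ (y, A) with hv
  have hv' : v.ofLp = Aᵀ *ᵥ (φ y).ofLp := rfl
  have hs := innovScale_pos hσ v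
  have hvv : v.ofLp ⬝ᵥ v.ofLp = innovScale σ v ^ 2 - σ ^ 2 := by
    rw [innovScale_sq, norm_sq_eq_dotProduct]; ring
  have h1 : (φ y).ofLp ⬝ᵥ ((A * Aᵀ) *ᵥ (φ y).ofLp) = v.ofLp ⬝ᵥ v.ofLp := by
    rw [← Matrix.mulVec_mulVec, Matrix.dotProduct_mulVec, ← Matrix.mulVec_transpose, hv']
  have h2 : A * Aᵀ * Matrix.vecMulVec (φ y).ofLp (φ y).ofLp * (A * Aᵀ) =
      A * Matrix.vecMulVec v.ofLp v.ofLp * Aᵀ := by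
    rw [hv']
    simp only [Matrix.mul_vecMulVec, Matrix.vecMulVec_mul, Matrix.mulVec_mulVec]
    simp only [← Matrix.mulVec_transpose, Matrix.transpose_mul, Matrix.transpose_transpose,
      Matrix.mulVec_mulVec]
  have h3 : Matrix.vecMulVec v.ofLp v.ofLp * Matrix.vecMulVec v.ofLp v.ofLp =
      (innovScale σ v ^ 2 - σ ^ 2) • Matrix.vecMulVec v.ofLp v.ofLp := by
    rw [Matrix.vecMulVec_mul_vecMulVec, hvv, Matrix.vecMulVec_smul]
  have h4 : (Matrix.vecMulVec v.ofLp v.ofLp)ᵀ = Matrix.vecMulVec v.ofLp v.ofLp := by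
    rw [Matrix.transpose_vecMulVec]
  simp only [LoopState.nextP, factorStep, ← hv, h1, h2]
  set V := Matrix.vecMulVec v.ofLp v.ofLp
  set s := innovScale σ v
  set κ := rankOneCoeff σ v with hκ
  have h5 : (A - κ • (A * V)) * (A - κ • (A * V))ᵀ =
      A * Aᵀ - (2 * κ - κ ^ 2 * (s ^ 2 - σ ^ 2)) • (A * V * Aᵀ) := by
    have h6 : A * V * V = (s ^ 2 - σ ^ 2) • (A * V) := by
      rw [Matrix.mul_assoc, h3, Matrix.mul_smul]
    rw [Matrix.transpose_sub, Matrix.transpose_smul, Matrix.transpose_mul, h4, mul_sub, sub_mul,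
      sub_mul]
    simp only [Matrix.smul_mul, Matrix.mul_smul, ← Matrix.mul_assoc, h6]
    module
  rw [h5, hvv]
  congr 2
  rw [hκ, rankOneCoeff]
  have : s + σ ≠ 0 := by positivity
  change _ = 2 * (s * (s + σ))⁻¹ - (s * (s + σ))⁻¹ ^ 2 * (s ^ 2 - σ ^ 2)
  have h7 : σ ^ 2 + (s ^ 2 - σ ^ 2) = s ^ 2 := by ring
  rw [h7]
  field_simp
  ring

/-- The factored recursion reproduces the closed loop: `P = A Aᵀ` and `θ̂ = θ - A z`. -/
lemma closedLoop_eq_factorLoop (φ : ℝ → EuclideanSpace ℝ (Fin n)) {σ : ℝ} (hσ : 0 < σ)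
    (θ0 θ : EuclideanSpace ℝ (Fin n)) (y0 : ℝ) (w : ℕ → ℝ) (t : ℕ) :
    closedLoop φ σ θ0 θ y0 w t =
      ⟨(factorLoop φ σ θ0 θ y0 w t).1.1,
        θ - WithLp.toLp 2 ((factorLoop φ σ θ0 θ y0 w t).1.2 *ᵥ
          (factorLoop φ σ θ0 θ y0 w t).2.ofLp),
        (factorLoop φ σ θ0 θ y0 w t).1.2 * (factorLoop φ σ θ0 θ y0 w t).1.2ᵀ⟩ := by
  induction t with
  | zero => simp [closedLoop, factorLoop]
  | succ t ih =>
    rw [closedLoop, ih, factorLoop]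
    obtain ⟨⟨y, A⟩, z⟩ := factorLoop φ σ θ0 θ y0 w t
    simp only
    set v := whitenedRegressor φ (y, A) with hv
    set r := innovRotation σ v (z, w (t + 1) / σ) with hr
    have hs := innovScale_pos hσ v
    have hY : (LoopState.mk y (θ - WithLp.toLp 2 (A *ᵥ z.ofLp)) (A * Aᵀ)).nextY φ θ (w (t + 1)) =
        innovScale σ v * r.2 := by
      simp only [LoopState.nextY, LoopState.input, inner_sub_left, hr, innovRotation]
      rw [inner_mulVec_eq, show WithLp.toLp 2 (Aᵀ *ᵥ (φ y).ofLp) = v from rfl]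
      field_simp
      ring
    have hP := nextP_eq (φ := φ) hσ y (θ - WithLp.toLp 2 (A *ᵥ z.ofLp)) A r.2
    have hgain : Matrix.toEuclideanLin ((LoopState.mk y (θ - WithLp.toLp 2 (A *ᵥ z.ofLp))
        (A * Aᵀ)).nextP φ σ) (φ y) =
          (σ ^ 2 / innovScale σ v ^ 2) • WithLp.toLp 2 (A *ᵥ v.ofLp) := by
      have h1 := rankOneCoeff_mul_norm_sq hσ v
      rw [norm_sq_eq_dotProduct] at h1
      have h2 : v.ofLp - (rankOneCoeff σ v * (v.ofLp ⬝ᵥ v.ofLp)) • v.ofLp =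
          (σ / innovScale σ v) • v.ofLp := by
        rw [← h1, sub_smul, one_smul]
      have h3 : (A - rankOneCoeff σ v • (A * Matrix.vecMulVec v.ofLp v.ofLp))ᵀ *ᵥ (φ y).ofLp =
          (σ / innovScale σ v) • v.ofLp := by
        rw [Matrix.transpose_sub, Matrix.transpose_smul, Matrix.transpose_mul,
          Matrix.transpose_vecMulVec, Matrix.sub_mulVec, Matrix.smul_mulVec,
          ← Matrix.mulVec_mulVec, show Aᵀ *ᵥ (φ y).ofLp = v.ofLp from rfl,
          Matrix.vecMulVec_mulVec, ← h2]
        simp [smul_smul]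
      rw [hP, Matrix.toLpLin_apply, ← Matrix.mulVec_mulVec]
      simp only [factorStep, ← hv]
      rw [h3, Matrix.mulVec_smul, factor_mulVec, h2, Matrix.mulVec_smul, smul_smul,
        WithLp.toLp_smul]
      congr 1
      ring
    have hE : (LoopState.mk y (θ - WithLp.toLp 2 (A *ᵥ z.ofLp)) (A * Aᵀ)).nextEst φ σ θ
        (w (t + 1)) = θ - WithLp.toLp 2 ((factorStep φ σ (y, A) r.2).2 *ᵥ r.1.ofLp) := by
      have h1 : r.1.ofLp - (rankOneCoeff σ v * (v.ofLp ⬝ᵥ r.1.ofLp)) • v.ofLp =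
          z.ofLp - (r.2 / innovScale σ v) • v.ofLp := by
        have := congrArg WithLp.ofLp (innovRotation_fst_sub hσ v z (w (t + 1) / σ))
        rw [inner_eq_dotProduct] at this
        simpa using this
      simp only [LoopState.nextEst, hgain, hY]
      simp only [factorStep, ← hv]
      rw [factor_mulVec, h1, Matrix.mulVec_sub, Matrix.mulVec_smul, WithLp.toLp_sub,
        WithLp.toLp_smul, LoopState.input, real_inner_comm, smul_smul]
      have h2 : (σ ^ 2)⁻¹ * (innovScale σ v * r.2 -
          -⟪φ y, θ - WithLp.toLp 2 (A *ᵥ z.ofLp)⟫ - ⟪φ y, θ - WithLp.toLp 2 (A *ᵥ z.ofLp)⟫) *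
            (σ ^ 2 / innovScale σ v ^ 2) = r.2 / innovScale σ v := by
        field_simp
        ring
      rw [h2]
      abel
    rw [hY, hE, hP]
    rfl

/-- The information matrix `1 + σ⁻² ∑_{i < t} φ(y_i) φ(y_i)ᵀ`. -/
noncomputable def infoMatrix (φ : ℝ → EuclideanSpace ℝ (Fin n)) (σ : ℝ) (y : ℕ → ℝ) (t : ℕ) :
    Matrix (Fin n) (Fin n) ℝ :=
  1 + (σ ^ 2)⁻¹ • ∑ i ∈ Finset.range t, Matrix.vecMulVec (φ (y i)).ofLp (φ (y i)).ofLp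

/-- The Sherman–Morrison formula along the recursion for `P`. -/
lemma infoMatrix_mul_P (φ : ℝ → EuclideanSpace ℝ (Fin n)) {σ : ℝ} (hσ : 0 < σ)
    (θ0 θ : EuclideanSpace ℝ (Fin n)) (y0 : ℝ) (w : ℕ → ℝ) (t : ℕ) :
    infoMatrix φ σ (fun i => (closedLoop φ σ θ0 θ y0 w i).y) t *
      (closedLoop φ σ θ0 θ y0 w t).P = 1 := by
  induction t with
  | zero => simp [infoMatrix, closedLoop]
  | succ t ih =>
    have hQ : infoMatrix φ σ (fun i => (closedLoop φ σ θ0 θ y0 w i).y) (t + 1) =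
        infoMatrix φ σ (fun i => (closedLoop φ σ θ0 θ y0 w i).y) t + (σ ^ 2)⁻¹ •
          Matrix.vecMulVec (φ (closedLoop φ σ θ0 θ y0 w t).y).ofLp
            (φ (closedLoop φ σ θ0 θ y0 w t).y).ofLp := by
      simp [infoMatrix, Finset.sum_range_succ, add_assoc]
    have hpos : 0 ≤ (φ (closedLoop φ σ θ0 θ y0 w t).y).ofLp ⬝ᵥ
        ((closedLoop φ σ θ0 θ y0 w t).P *ᵥ (φ (closedLoop φ σ θ0 θ y0 w t).y).ofLp) := by
      rw [closedLoop_eq_factorLoop φ hσ]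
      simp only
      rw [← Matrix.mulVec_mulVec, Matrix.dotProduct_mulVec, ← Matrix.mulVec_transpose,
        ← norm_sq_eq_dotProduct (WithLp.toLp 2 _)]
      positivity
    rw [hQ]
    simp only [closedLoop, LoopState.nextP]
    set P := (closedLoop φ σ θ0 θ y0 w t).P
    set u := (φ (closedLoop φ σ θ0 θ y0 w t).y).ofLp
    set Q := infoMatrix φ σ (fun i => (closedLoop φ σ θ0 θ y0 w i).y) t
    set d := u ⬝ᵥ (P *ᵥ u)
    set U := Matrix.vecMulVec u u with hU
    have h1 : U * P * U = d • U := by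
      rw [Matrix.mul_assoc, hU, Matrix.mul_vecMulVec, Matrix.vecMulVec_mul_vecMulVec,
        Matrix.vecMulVec_smul]
    have h2 : Q * (P * U * P) = U * P := by
      rw [← Matrix.mul_assoc, ← Matrix.mul_assoc, ih, one_mul]
    have h3 : U * (P * U * P) = d • (U * P) := by
      rw [← Matrix.mul_assoc, ← Matrix.mul_assoc, h1, Matrix.smul_mul]
    rw [mul_sub, add_mul, add_mul, ih]
    simp only [Matrix.mul_smul, Matrix.smul_mul, h2, h3]
    have hd : σ ^ 2 + d ≠ 0 := by positivity
    have h4 : (σ ^ 2)⁻¹ - (σ ^ 2 + d)⁻¹ - (σ ^ 2 + d)⁻¹ * ((σ ^ 2)⁻¹ * d) = 0 := by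
      field_simp
      ring
    calc _ = 1 + ((σ ^ 2)⁻¹ - (σ ^ 2 + d)⁻¹ - (σ ^ 2 + d)⁻¹ * ((σ ^ 2)⁻¹ * d)) • (U * P) := by
          module
      _ = 1 := by rw [h4, zero_smul, add_zero]

lemma dotProduct_infoMatrix_mulVec (φ : ℝ → EuclideanSpace ℝ (Fin n)) (σ : ℝ) (y : ℕ → ℝ) (t : ℕ)
    (x : EuclideanSpace ℝ (Fin n)) :
    x.ofLp ⬝ᵥ (infoMatrix φ σ y t *ᵥ x.ofLp) =
      ‖x‖ ^ 2 + (σ ^ 2)⁻¹ * ∑ i ∈ Finset.range t, ⟪x, φ (y i)⟫ ^ 2 := by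
  rw [infoMatrix, Matrix.add_mulVec, Matrix.smul_mulVec, Matrix.sum_mulVec, dotProduct_add,
    Matrix.one_mulVec, ← norm_sq_eq_dotProduct, dotProduct_smul, dotProduct_sum, smul_eq_mul]
  congr 2
  refine Finset.sum_congr rfl fun i _ => ?_
  rw [Matrix.vecMulVec_mulVec, inner_eq_dotProduct]
  simp [dotProduct_comm, sq]

lemma isHermitian_infoMatrix (φ : ℝ → EuclideanSpace ℝ (Fin n)) (σ : ℝ) (y : ℕ → ℝ) (t : ℕ) :
    (infoMatrix φ σ y t).IsHermitian := by
  unfold infoMatrix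
  rw [Matrix.IsHermitian, Matrix.conjTranspose_add, Matrix.conjTranspose_smul,
    Matrix.conjTranspose_sum]
  simp

/-- The smallest eigenvalue is bounded below by the quadratic form on the unit sphere. Symmetry
enters only to ensure that the set of real eigenvalues is not empty. -/
lemma le_minEigenvalue [NeZero n] {Q : Matrix (Fin n) (Fin n) ℝ} (hQ : Q.IsHermitian) {c : ℝ}
    (hc : ∀ x : EuclideanSpace ℝ (Fin n), c * ‖x‖ ^ 2 ≤ x.ofLp ⬝ᵥ (Q *ᵥ x.ofLp)) :
    c ≤ minEigenvalue Q := by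
  refine le_csInf ?_ ?_
  · refine ⟨hQ.eigenvalues 0, ?_⟩
    refine Module.End.hasEigenvalue_of_hasEigenvector (x := (hQ.eigenvectorBasis 0).ofLp)
      ⟨Module.End.mem_eigenspace_iff.2 ?_, ?_⟩
    · simpa using hQ.mulVec_eigenvectorBasis 0
    · intro h0
      exact hQ.eigenvectorBasis.toBasis.ne_zero 0 (by
        rw [OrthonormalBasis.coe_toBasis]
        exact (WithLp.ofLp_eq_zero 2).1 h0)
  · rintro r hr
    obtain ⟨x, hx⟩ := hr.exists_hasEigenvector
    have h1 := hx.apply_eq_smul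
    rw [Matrix.toLin'_apply] at h1
    have h2 := hc (WithLp.toLp 2 x)
    simp only at h2
    rw [h1, dotProduct_smul, smul_eq_mul, ← norm_sq_eq_dotProduct (WithLp.toLp 2 x)] at h2
    have h3 : 0 < ‖WithLp.toLp 2 x‖ := by
      rw [norm_pos_iff]
      exact fun h => hx.2 ((WithLp.toLp_eq_zero 2).1 h)
    exact le_of_mul_le_mul_right h2 (by positivity)

end Factor

/-! ### Pathwise analysis -/

section Pathwise

lemma eventually_log_le_mul {ε : ℝ} (hε : 0 < ε) :
    ∀ᶠ t : ℕ in atTop, Real.log (t + 1) ≤ ε * t := by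
  have h1 : Tendsto (fun t : ℕ => (t : ℝ) + 1) atTop atTop :=
    tendsto_atTop_add_const_right _ _ tendsto_natCast_atTop_atTop
  have h2 := h1.eventually (Real.isLittleO_log_id_atTop.bound (half_pos hε))
  filter_upwards [h2, eventually_ge_atTop 1] with t ht ht1
  have ht1' : (1 : ℝ) ≤ t := by exact_mod_cast ht1
  simp only [id, Real.norm_eq_abs] at ht
  rw [abs_of_pos (by positivity : (0 : ℝ) < t + 1)] at ht
  nlinarith [le_abs_self (Real.log ((t : ℝ) + 1))]

/-- Excitation of all directions: by compactness of the unit sphere, finitely many intervals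
suffice to detect every nontrivial combination of linearly independent continuous functions. -/
lemma exists_finset_Ioo_le_abs_inner {n : ℕ} {φ : ℝ → EuclideanSpace ℝ (Fin n)} {E : Set ℝ}
    (hE : IsOpen E) (hcont : ∀ j, ContinuousOn (fun x => φ x j) E)
    (hlin : LinearIndependent ℝ (fun (j : Fin n) (x : E) => φ x j)) :
    ∃ I : Finset (ℝ × ℝ), (∀ q ∈ I, q.1 < q.2) ∧ ∃ δ : ℝ, 0 < δ ∧
      ∀ x : EuclideanSpace ℝ (Fin n), ‖x‖ = 1 → ∃ q ∈ I, ∀ r ∈ Ioo q.1 q.2, δ ≤ |⟪x, φ r⟫| := by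
  have hφc : ContinuousOn φ E :=
    (PiLp.continuous_toLp 2 _).comp_continuousOn (continuousOn_pi.2 hcont)
  have key := (isCompact_sphere (0 : EuclideanSpace ℝ (Fin n)) 1).induction_on
    (p := fun s => ∃ I : Finset (ℝ × ℝ), (∀ q ∈ I, q.1 < q.2) ∧ ∃ δ : ℝ, 0 < δ ∧
      ∀ x ∈ s, ∃ q ∈ I, ∀ r ∈ Ioo q.1 q.2, δ ≤ |⟪x, φ r⟫|)
    ⟨∅, by simp, 1, one_pos, by simp⟩
    (fun s t hst ⟨I, hI, δ, hδ, h⟩ => ⟨I, hI, δ, hδ, fun x hx => h x (hst hx)⟩)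
    (fun s t ⟨I, hI, δ, hδ, h⟩ ⟨J, hJ, ε, hε, h'⟩ => by
      classical
      refine ⟨I ∪ J, fun q hq => (Finset.mem_union.1 hq).elim (hI q) (hJ q), min δ ε,
        lt_min hδ hε, fun x hx => ?_⟩
      rcases hx with hx | hx
      · obtain ⟨q, hq, hr⟩ := h x hx
        exact ⟨q, Finset.mem_union_left _ hq, fun r h1 => (min_le_left _ _).trans (hr r h1)⟩
      · obtain ⟨q, hq, hr⟩ := h' x hx
        exact ⟨q, Finset.mem_union_right _ hq, fun r h1 => (min_le_right _ _).trans (hr r h1)⟩)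
    (fun x hx => by
      have hx0 : x ≠ 0 := by
        rintro rfl
        simp at hx
      obtain ⟨r, hr, hne⟩ : ∃ r ∈ E, ⟪x, φ r⟫ ≠ 0 := by
        by_contra! hcon
        refine hx0 (PiLp.ext fun j => ?_)
        refine Fintype.linearIndependent_iff.1 hlin x (funext fun r => ?_) j
        have := hcon r r.2
        rw [inner_eq_dotProduct] at this
        simpa [dotProduct, Finset.sum_apply] using this
      have hca : ContinuousAt (fun p : EuclideanSpace ℝ (Fin n) × ℝ => |⟪p.1, φ p.2⟫|) (x, r) := by
        have h1 : ContinuousAt (fun p : EuclideanSpace ℝ (Fin n) × ℝ => φ p.2) (x, r) :=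
          ContinuousAt.comp (f := Prod.snd) (hφc.continuousAt (hE.mem_nhds hr))
            continuousAt_snd
        exact (continuousAt_fst.inner h1).abs
      have hpos : 0 < |⟪x, φ r⟫| := abs_pos.2 hne
      have hev : ∀ᶠ p in 𝓝 (x, r), |⟪x, φ r⟫| / 2 < |⟪p.1, φ p.2⟫| :=
        hca.eventually (lt_mem_nhds (half_lt_self hpos))
      rw [nhds_prod_eq] at hev
      obtain ⟨U, hU, V, hV, hUV⟩ := Filter.eventually_prod_iff.1 hev
      obtain ⟨a, b, hab, hV'⟩ := mem_nhds_iff_exists_Ioo_subset.1 hV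
      refine ⟨_, mem_nhdsWithin_of_mem_nhds hU, {(a, b)}, ?_, |⟪x, φ r⟫| / 2, half_pos hpos, ?_⟩
      · simpa using hab.1.trans hab.2
      · exact fun x' hx' => ⟨(a, b), by simp, fun r' hr' => (hUV hx' (hV' hr')).le⟩)
  obtain ⟨I, hI, δ, hδ, h⟩ := key
  exact ⟨I, hI, δ, hδ, fun x hx => h x (by simpa using hx)⟩

/-- If `∑ y_i² = O(t)`, the scales `s_i` stay below some level for at least half of the time. -/
lemma exists_eventually_half_le_card {s e : ℕ → ℝ} {p C : ℝ} (hp : 0 < p)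
    (hcount : ∀ M : ℕ, ∀ᶠ t : ℕ in atTop,
      p / 2 * ((Finset.range t).filter fun i => (M : ℝ) < s i).card ≤
        ((Finset.range t).filter fun i => (M : ℝ) < s i ∧ e i ∈ Ioo (1 : ℝ) 2).card +
          2 * Real.log (t + 1))
    (hC : ∀ᶠ t : ℕ in atTop, ∑ i ∈ Finset.range t, (s i * e i) ^ 2 ≤ C * t) :
    ∃ M : ℕ, ∀ᶠ t : ℕ in atTop,
      (t : ℝ) / 2 ≤ ((Finset.range t).filter fun i => s i ≤ (M : ℝ)).card := by
  obtain ⟨M, hM⟩ := exists_nat_ge (max 1 (8 * C / p))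
  have hM1 : (1 : ℝ) ≤ M := (le_max_left _ _).trans hM
  have hMC : C ≤ p / 8 * (M : ℝ) ^ 2 := by
    have h1 := (le_max_right _ _).trans hM
    rw [div_le_iff₀ hp] at h1
    have h2 : (M : ℝ) ≤ (M : ℝ) ^ 2 := by nlinarith
    linarith [mul_le_mul_of_nonneg_left h2 hp.le]
  refine ⟨M, ?_⟩
  filter_upwards [hcount M, hC, eventually_log_le_mul (by positivity : 0 < p / 16)] with t h1 h2 h3
  set N := ((Finset.range t).filter fun i => (M : ℝ) < s i).card
  set H := (Finset.range t).filter fun i => (M : ℝ) < s i ∧ e i ∈ Ioo (1 : ℝ) 2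
  have h4 : (H.card : ℝ) * (M : ℝ) ^ 2 ≤ C * t := by
    refine le_trans ?_ h2
    rw [← nsmul_eq_mul]
    refine (Finset.card_nsmul_le_sum H (fun i => (s i * e i) ^ 2) _ fun i hi => ?_).trans
      (Finset.sum_le_sum_of_subset_of_nonneg (Finset.filter_subset _ _)
        fun _ _ _ => sq_nonneg _)
    obtain ⟨-, hi1, hi2, -⟩ := Finset.mem_filter.1 hi
    exact pow_le_pow_left₀ (by positivity) (by nlinarith) 2
  have h5 : (H.card : ℝ) ≤ p / 8 * t := by
    have h6 : (H.card : ℝ) * (M : ℝ) ^ 2 ≤ (p / 8 * t) * (M : ℝ) ^ 2 := by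
      have := mul_le_mul_of_nonneg_right hMC (Nat.cast_nonneg (α := ℝ) t)
      linarith
    exact le_of_mul_le_mul_right h6 (by positivity)
  have h6 : (N : ℝ) ≤ t / 2 := by
    have : p / 2 * (N : ℝ) ≤ p / 2 * (t / 2) := by linarith
    exact le_of_mul_le_mul_left this (by positivity)
  have h7 : ((Finset.range t).filter fun i => s i ≤ (M : ℝ)).card + N = t := by
    have := Finset.card_filter_add_card_filter_not (s := Finset.range t)
      (fun i => s i ≤ (M : ℝ))
    simpa [N, not_le] using this
  have h8 : (((Finset.range t).filter fun i => s i ≤ (M : ℝ)).card : ℝ) + N = t := by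
    exact_mod_cast h7
  linarith

/-- Linear growth of the information matrix, once the scales are bounded half of the time and
every detecting interval receives its share of the outputs. -/
lemma exists_eventually_le_infoMatrix {n : ℕ} {φ : ℝ → EuclideanSpace ℝ (Fin n)} {σ : ℝ}
    (hσ : 0 < σ) {y s : ℕ → ℝ} {I : Finset (ℝ × ℝ)} {δ : ℝ} (hδ : 0 < δ)
    (hI : ∀ x : EuclideanSpace ℝ (Fin n), ‖x‖ = 1 →
      ∃ q ∈ I, ∀ r ∈ Ioo q.1 q.2, δ ≤ |⟪x, φ r⟫|) {M : ℝ}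
    (hcount : ∀ q ∈ I, ∃ p : ℝ, 0 < p ∧ ∀ᶠ t : ℕ in atTop,
      p / 2 * ((Finset.range t).filter fun i => s i ≤ M).card ≤
        ((Finset.range t).filter fun i => s i ≤ M ∧ y (i + 1) ∈ Ioo q.1 q.2).card +
          2 * Real.log (t + 1))
    (hM : ∀ᶠ t : ℕ in atTop, (t : ℝ) / 2 ≤ ((Finset.range t).filter fun i => s i ≤ M).card) :
    ∃ c : ℝ, 0 < c ∧ ∀ᶠ t : ℕ in atTop, ∀ x : EuclideanSpace ℝ (Fin n),
      c * t * ‖x‖ ^ 2 ≤ x.ofLp ⬝ᵥ (infoMatrix φ σ y t *ᵥ x.ofLp) := by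
  have h1 : ∀ q ∈ I, ∃ c : ℝ, 0 < c ∧ ∀ᶠ t : ℕ in atTop,
      c * t ≤ ((Finset.range t).filter fun i => y (i + 1) ∈ Ioo q.1 q.2).card := by
    intro q hq
    obtain ⟨p, hp, h⟩ := hcount q hq
    refine ⟨p / 8, by positivity, ?_⟩
    filter_upwards [h, hM, eventually_log_le_mul (by positivity : 0 < p / 16)] with t h2 h3 h4
    have h5 : ((Finset.range t).filter fun i => s i ≤ M ∧ y (i + 1) ∈ Ioo q.1 q.2).card ≤
        ((Finset.range t).filter fun i => y (i + 1) ∈ Ioo q.1 q.2).card :=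
      Finset.card_le_card (Finset.monotone_filter_right _ fun i _ hi => hi.2)
    have h6 : (((Finset.range t).filter
        fun i => s i ≤ M ∧ y (i + 1) ∈ Ioo q.1 q.2).card : ℝ) ≤
        ((Finset.range t).filter fun i => y (i + 1) ∈ Ioo q.1 q.2).card := by exact_mod_cast h5
    have h7 := mul_le_mul_of_nonneg_left h3 (by positivity : 0 ≤ p / 2)
    linarith
  obtain ⟨c, hc, h2⟩ : ∃ c : ℝ, 0 < c ∧ ∀ᶠ t : ℕ in atTop, ∀ q ∈ I,
      c * t ≤ ((Finset.range t).filter fun i => y (i + 1) ∈ Ioo q.1 q.2).card := by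
    clear hI hcount
    induction I using Finset.induction_on with
    | empty => exact ⟨1, one_pos, by simp⟩
    | insert q I _ ih =>
      obtain ⟨c, hc, h3⟩ := ih fun q hq => h1 q (Finset.mem_insert_of_mem hq)
      obtain ⟨d, hd, h4⟩ := h1 q (Finset.mem_insert_self _ _)
      refine ⟨min c d, lt_min hc hd, ?_⟩
      filter_upwards [h3, h4] with t h5 h6 q' hq'
      have ht : (0 : ℝ) ≤ t := by positivity
      rcases Finset.mem_insert.1 hq' with rfl | hq'
      · exact (mul_le_mul_of_nonneg_right (min_le_right _ _) ht).trans h6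
      · exact (mul_le_mul_of_nonneg_right (min_le_left _ _) ht).trans (h5 q' hq')
  refine ⟨(σ ^ 2)⁻¹ * (c * δ ^ 2) / 2, by positivity, ?_⟩
  have h3 : ∀ᶠ t : ℕ in atTop, ∀ x : EuclideanSpace ℝ (Fin n),
      (σ ^ 2)⁻¹ * (c * δ ^ 2) / 2 * ((t + 1 : ℕ) : ℝ) * ‖x‖ ^ 2 ≤
        x.ofLp ⬝ᵥ (infoMatrix φ σ y (t + 1) *ᵥ x.ofLp) := by
    filter_upwards [h2, eventually_ge_atTop 1] with t ht ht1 x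
    have ht1' : (1 : ℝ) ≤ t := by exact_mod_cast ht1
    rw [dotProduct_infoMatrix_mulVec, Finset.sum_range_succ']
    have h4 : c * δ ^ 2 * t * ‖x‖ ^ 2 ≤ ∑ i ∈ Finset.range t, ⟪x, φ (y (i + 1))⟫ ^ 2 := by
      by_cases hx : x = 0
      · subst hx; simp
      have hxn : 0 < ‖x‖ := norm_pos_iff.2 hx
      obtain ⟨q, hq, hr⟩ := hI (‖x‖⁻¹ • x) (by
        rw [norm_smul, norm_inv, norm_norm, inv_mul_cancel₀ hxn.ne'])
      set H := (Finset.range t).filter fun i => y (i + 1) ∈ Ioo q.1 q.2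
      calc c * δ ^ 2 * t * ‖x‖ ^ 2 = c * t * (δ * ‖x‖) ^ 2 := by ring
        _ ≤ H.card * (δ * ‖x‖) ^ 2 := by gcongr; exact ht q hq
        _ = H.card • (δ * ‖x‖) ^ 2 := by rw [nsmul_eq_mul]
        _ ≤ ∑ i ∈ H, ⟪x, φ (y (i + 1))⟫ ^ 2 := by
            refine Finset.card_nsmul_le_sum _ _ _ fun i hi => ?_
            have h5 := hr _ (Finset.mem_filter.1 hi).2
            rw [real_inner_smul_left, abs_mul, abs_of_pos (inv_pos.2 hxn),
              le_inv_mul_iff₀ hxn] at h5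
            rw [← sq_abs ⟪x, φ (y (i + 1))⟫]
            exact pow_le_pow_left₀ (by positivity) (by linarith) 2
        _ ≤ _ := Finset.sum_le_sum_of_subset_of_nonneg (Finset.filter_subset _ _)
            fun _ _ _ => sq_nonneg _
    have h6 : c * δ ^ 2 / 2 * ((t + 1 : ℕ) : ℝ) * ‖x‖ ^ 2 ≤ c * δ ^ 2 * t * ‖x‖ ^ 2 := by
      have : c * δ ^ 2 / 2 * ((t + 1 : ℕ) : ℝ) ≤ c * δ ^ 2 * t := by
        push_cast
        nlinarith [(by positivity : 0 < c * δ ^ 2)]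
      gcongr
    calc (σ ^ 2)⁻¹ * (c * δ ^ 2) / 2 * ((t + 1 : ℕ) : ℝ) * ‖x‖ ^ 2 =
          (σ ^ 2)⁻¹ * (c * δ ^ 2 / 2 * ((t + 1 : ℕ) : ℝ) * ‖x‖ ^ 2) := by ring
      _ ≤ (σ ^ 2)⁻¹ * (∑ i ∈ Finset.range t, ⟪x, φ (y (i + 1))⟫ ^ 2 + ⟪x, φ (y 0)⟫ ^ 2) := by
          gcongr
          nlinarith [sq_nonneg ⟪x, φ (y 0)⟫]
      _ ≤ _ := le_add_of_nonneg_left (by positivity)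
  obtain ⟨T, hT⟩ := eventually_atTop.1 h3
  filter_upwards [eventually_ge_atTop (T + 1)] with t ht
  obtain ⟨k, rfl⟩ := Nat.exists_eq_add_of_le' (show 1 ≤ t by omega)
  exact hT k (by omega)

/-- Consequences of a lower bound on `Q = (A Aᵀ)⁻¹` for the factor `A` and its transpose. -/
lemma mul_norm_sq_le_of_mul_factor_eq_one {n : ℕ} {Q A : Matrix (Fin n) (Fin n) ℝ}
    (hQA : Q * (A * Aᵀ) = 1) {c : ℝ} (hc : 0 ≤ c)
    (hQ : ∀ x : EuclideanSpace ℝ (Fin n), c * ‖x‖ ^ 2 ≤ x.ofLp ⬝ᵥ (Q *ᵥ x.ofLp))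
    (u : EuclideanSpace ℝ (Fin n)) :
    c * ‖WithLp.toLp 2 (A *ᵥ u.ofLp)‖ ^ 2 ≤ ‖u‖ ^ 2 ∧
      c * ‖WithLp.toLp 2 (Aᵀ *ᵥ u.ofLp)‖ ^ 2 ≤ ‖u‖ ^ 2 := by
  have hAQA : Aᵀ * (Q * A) = 1 := by
    rw [← Matrix.mul_assoc] at hQA
    exact mul_eq_one_comm.1 hQA
  have key : ∀ z : EuclideanSpace ℝ (Fin n),
      c * ‖WithLp.toLp 2 (A *ᵥ z.ofLp)‖ ^ 2 ≤ ‖z‖ ^ 2 := by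
    intro z
    refine (hQ _).trans_eq ?_
    simp only
    rw [Matrix.mulVec_mulVec, dotProduct_comm, Matrix.dotProduct_mulVec, ← Matrix.mulVec_transpose,
      Matrix.mulVec_mulVec, hAQA, Matrix.one_mulVec, norm_sq_eq_dotProduct]
  refine ⟨key u, ?_⟩
  set v : EuclideanSpace ℝ (Fin n) := WithLp.toLp 2 (Aᵀ *ᵥ u.ofLp) with hv
  have h1 := key v
  have h2 : ‖v‖ ^ 2 = ⟪WithLp.toLp 2 (A *ᵥ v.ofLp), u⟫ := by
    rw [inner_mulVec_eq, ← real_inner_self_eq_norm_sq]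
  have h3 := real_inner_le_norm (WithLp.toLp 2 (A *ᵥ v.ofLp)) u
  rw [← h2] at h3
  rcases eq_or_ne v 0 with h0 | h0
  · rw [h0]; simp
  have h4 : 0 < ‖v‖ ^ 2 := by have := norm_pos_iff.2 h0; positivity
  refine le_of_mul_le_mul_right ?_ h4
  calc c * ‖v‖ ^ 2 * ‖v‖ ^ 2 = c * (‖v‖ ^ 2) ^ 2 := by ring
    _ ≤ c * (‖WithLp.toLp 2 (A *ᵥ v.ofLp)‖ * ‖u‖) ^ 2 := by gcongr
    _ = c * ‖WithLp.toLp 2 (A *ᵥ v.ofLp)‖ ^ 2 * ‖u‖ ^ 2 := by ring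
    _ ≤ ‖v‖ ^ 2 * ‖u‖ ^ 2 := by gcongr
    _ = ‖u‖ ^ 2 * ‖v‖ ^ 2 := by ring

/-- The scales converge to `σ`. Once `s_t` is below the level `M` at some late time, the next
output is `O(√log t)`, so that `φ(y_{t+1})` is negligible against `√t` whatever the exponent `b`,
and `s_{t+1}` is close to `σ`; this repeats for ever. -/
lemma tendsto_scale_sq {G : Type*} [NormedAddCommGroup G] {φ : ℝ → G} {b K₁ K₂ : ℝ} (hb : 0 < b)
    (hgrowth : ∀ x : ℝ, ‖φ x‖ ≤ K₁ + K₂ * |x| ^ b) {σ c K M : ℝ} (hc : 0 < c) (hK : 0 < K)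
    {y s e : ℕ → ℝ} (hy : ∀ t, y (t + 1) = s t * e t) (hs0 : ∀ t, σ ^ 2 ≤ s t ^ 2)
    (hs : ∀ᶠ t : ℕ in atTop, c * t * (s t ^ 2 - σ ^ 2) ≤ ‖φ (y t)‖ ^ 2)
    (he : ∀ᶠ t : ℕ in atTop, e t ^ 2 ≤ K * Real.log (t + 1))
    (hfreq : ∃ᶠ t : ℕ in atTop, s t ^ 2 ≤ M) :
    Tendsto (fun t => s t ^ 2) atTop (𝓝 (σ ^ 2)) := by
  set N := max M (σ ^ 2 + 1) with hN
  have hN0 : 0 < N := lt_of_lt_of_le (by positivity) (le_max_right _ _)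
  set ρ : ℕ → ℝ := fun t => c⁻¹ * (2 * K₁ ^ 2 * ((t : ℝ) + 1)⁻¹ +
    2 * K₂ ^ 2 * (N * K) ^ b * (Real.log ((t : ℝ) + 1) ^ b / ((t : ℝ) + 1))) with hρ
  have hcast : Tendsto (fun t : ℕ => (t : ℝ) + 1) atTop atTop :=
    tendsto_atTop_add_const_right _ _ tendsto_natCast_atTop_atTop
  have hρ0 : Tendsto ρ atTop (𝓝 0) := by
    have h1 : Tendsto (fun t : ℕ => ((t : ℝ) + 1)⁻¹) atTop (𝓝 0) :=
      tendsto_inv_atTop_zero.comp hcast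
    have h2 : Tendsto (fun t : ℕ => Real.log ((t : ℝ) + 1) ^ b / ((t : ℝ) + 1)) atTop (𝓝 0) := by
      have := (isLittleO_log_rpow_rpow_atTop b one_pos).tendsto_div_nhds_zero.comp hcast
      simpa [Function.comp_def] using this
    have := ((h1.const_mul (2 * K₁ ^ 2)).add (h2.const_mul (2 * K₂ ^ 2 * (N * K) ^ b))).const_mul
      c⁻¹
    simpa [hρ] using this
  have hstep : ∀ᶠ t : ℕ in atTop, s t ^ 2 ≤ N → s (t + 1) ^ 2 - σ ^ 2 ≤ ρ t := by
    filter_upwards [he, (tendsto_add_atTop_nat 1).eventually hs] with t h1 h2 h3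
    have ht : (0 : ℝ) < (t : ℝ) + 1 := by positivity
    have hlog : 0 ≤ Real.log ((t : ℝ) + 1) :=
      Real.log_nonneg (by linarith [Nat.cast_nonneg (α := ℝ) t])
    have h4 : y (t + 1) ^ 2 ≤ N * K * Real.log ((t : ℝ) + 1) := by
      rw [hy, mul_pow, mul_assoc]
      exact mul_le_mul h3 h1 (sq_nonneg _) hN0.le
    have h5 : (|y (t + 1)| ^ b) ^ 2 ≤ (N * K) ^ b * Real.log ((t : ℝ) + 1) ^ b := by
      rw [← Real.mul_rpow (by positivity) hlog, ← Real.rpow_natCast, ← Real.rpow_mul (abs_nonneg _),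
        mul_comm b, Real.rpow_mul (abs_nonneg _), Real.rpow_natCast, sq_abs]
      exact Real.rpow_le_rpow (sq_nonneg _) h4 hb.le
    have h6 : ‖φ (y (t + 1))‖ ^ 2 ≤ 2 * K₁ ^ 2 + 2 * K₂ ^ 2 * (|y (t + 1)| ^ b) ^ 2 := by
      have := pow_le_pow_left₀ (norm_nonneg _) (hgrowth (y (t + 1))) 2
      nlinarith [sq_nonneg (K₁ - K₂ * |y (t + 1)| ^ b)]
    have h7 : c * ((t : ℝ) + 1) * (s (t + 1) ^ 2 - σ ^ 2) ≤
        2 * K₁ ^ 2 + 2 * K₂ ^ 2 * ((N * K) ^ b * Real.log ((t : ℝ) + 1) ^ b) := by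
      have := mul_le_mul_of_nonneg_left h5 (by positivity : 0 ≤ 2 * K₂ ^ 2)
      push_cast at h2
      linarith
    have h8 : ρ t = (2 * K₁ ^ 2 + 2 * K₂ ^ 2 * ((N * K) ^ b * Real.log ((t : ℝ) + 1) ^ b)) /
        (c * ((t : ℝ) + 1)) := by
      simp only [hρ]
      field_simp
    rw [h8, le_div_iff₀ (by positivity)]
    linarith
  obtain ⟨T, hT⟩ := eventually_atTop.1 (hstep.and (hρ0.eventually (ge_mem_nhds one_pos)))
  obtain ⟨t₀, ht₀, hst₀⟩ := frequently_atTop.1 hfreq T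
  have htrap : ∀ t, t₀ ≤ t → s t ^ 2 ≤ N := by
    intro t ht
    induction t, ht using Nat.le_induction with
    | base => exact hst₀.trans (le_max_left _ _)
    | succ t ht ih =>
      obtain ⟨h1, h2⟩ := hT t (ht₀.trans ht)
      exact le_trans (by linarith [h1 ih]) (le_max_right M (σ ^ 2 + 1))
  rw [← tendsto_add_atTop_iff_nat 1]
  refine tendsto_of_tendsto_of_tendsto_of_le_of_le' tendsto_const_nhds
    (by simpa using hρ0.const_add (σ ^ 2)) (Eventually.of_forall fun t => hs0 _) ?_
  filter_upwards [eventually_ge_atTop t₀] with t ht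
  linarith [(hT t (ht₀.trans ht)).1 (htrap t ht)]

/-- Cesàro means with convergent weights. -/
lemma tendsto_weighted_mean {a r : ℕ → ℝ} {l : ℝ} (ha : ∀ i, 0 ≤ a i)
    (hmean : Tendsto (fun t : ℕ => (∑ i ∈ Finset.range t, a i) / t) atTop (𝓝 1))
    (hr : Tendsto r atTop (𝓝 l)) :
    Tendsto (fun t : ℕ => (∑ i ∈ Finset.range t, r i * a i) / t) atTop (𝓝 l) := by
  have hsum : Tendsto (fun t : ℕ => ∑ i ∈ Finset.range t, a i) atTop atTop := by
    have := hmean.pos_mul_atTop one_pos (tendsto_natCast_atTop_atTop (R := ℝ))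
    refine this.congr' ?_
    filter_upwards [eventually_ne_atTop 0] with t ht
    field_simp
  have ho : (fun i => (r i - l) * a i) =o[atTop] a := by
    have h1 : (fun i => r i - l) =o[atTop] (fun _ => (1 : ℝ)) := by
      rw [isLittleO_one_iff]
      simpa using hr.sub_const l
    simpa using h1.mul_isBigO (isBigO_refl a atTop)
  have h2 := (ho.sum_range ha hsum).tendsto_div_nhds_zero
  have h3 := (h2.mul hmean).add (hmean.const_mul l)
  simp only [mul_one, zero_add] at h3
  refine h3.congr' ?_
  filter_upwards [hsum.eventually_gt_atTop 0] with t ht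
  rw [div_mul_div_cancel₀ ht.ne', ← mul_div_assoc, ← add_div, Finset.mul_sum,
    ← Finset.sum_add_distrib]
  congr 1
  exact Finset.sum_congr rfl fun i _ => by ring

/-- The shift `t + 1` costs only a constant factor, since `log (t + 2) ≤ 2 log t`. -/
lemma isBigO_log_div_of_eventually_le {f : ℕ → ℝ} (hf : ∀ t, 0 ≤ f t) {c K : ℝ} (hc : 0 < c)
    (hK : 0 < K) (h : ∀ᶠ t : ℕ in atTop, c * t * f t ≤ K * Real.log (t + 1)) :
    (fun t : ℕ => f (t + 1)) =O[atTop] (fun t : ℕ => Real.log t / t) := by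
  refine IsBigO.of_bound (2 * K / c) ?_
  filter_upwards [(tendsto_add_atTop_nat 1).eventually h, eventually_ge_atTop 2] with t h1 h2
  have ht : (2 : ℝ) ≤ t := by exact_mod_cast h2
  have hlog : 0 ≤ Real.log t := Real.log_nonneg (by linarith)
  -- `t + 2 ≤ t ^ 2` for `t ≥ 2`
  have h3 : Real.log (((t + 1 : ℕ) : ℝ) + 1) ≤ 2 * Real.log t := by
    rw [← Nat.cast_ofNat (n := 2), ← Real.log_pow]
    refine Real.log_le_log (by positivity) ?_
    push_cast
    nlinarith
  rw [Real.norm_of_nonneg (hf _), Real.norm_of_nonneg (by positivity), div_mul_div_comm,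
    le_div_iff₀ (by positivity)]
  push_cast at h1 h3
  have h4 := mul_le_mul_of_nonneg_left h3 hK.le
  nlinarith [mul_nonneg hc.le (hf (t + 1))]

end Pathwise

/-! ### The closed loop as an innovation system -/

section ClosedLoop

variable {Ω : Type*} [MeasurableSpace Ω] {μ : Measure Ω}

lemma indepFun_prodMk_left_of_indepFun_prodMk_right {α β γ : Type*} [MeasurableSpace α]
    [MeasurableSpace β] [MeasurableSpace γ] [IsProbabilityMeasure μ] {X : Ω → α} {Y : Ω → β} {Z : Ω → γ}
    (hX : Measurable X) (hY : Measurable Y) (hZ : Measurable Z)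
    (h : IndepFun X (fun ω => (Y ω, Z ω)) μ) (hYZ : IndepFun Y Z μ) :
    IndepFun (fun ω => (X ω, Y ω)) Z μ := by
  have hXY : IndepFun X Y μ := h.comp (φ := id) (ψ := Prod.fst) measurable_id measurable_fst
  rw [indepFun_iff_map_prod_eq_prod_map_map (by fun_prop) (by fun_prop)] at h hYZ hXY ⊢
  have := Measure.isProbabilityMeasure_map (μ := μ) hX.aemeasurable
  have := Measure.isProbabilityMeasure_map (μ := μ) hY.aemeasurable
  have := Measure.isProbabilityMeasure_map (μ := μ) hZ.aemeasurable
  rw [hXY, ← ((measurePreserving_prodAssoc (μ.map X) (μ.map Y) (μ.map Z)).symm _).map_eq, ← hYZ,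
    ← h, Measure.map_map (by fun_prop) (by fun_prop)]
  rfl

lemma measurable_whitenedRegressor {n : ℕ} {φ : ℝ → EuclideanSpace ℝ (Fin n)}
    (hφ : Measurable φ) : Measurable (whitenedRegressor φ) := by
  have h1 : Continuous fun p : Matrix (Fin n) (Fin n) ℝ × EuclideanSpace ℝ (Fin n) =>
      WithLp.toLp 2 (p.1ᵀ *ᵥ p.2.ofLp) :=
    (PiLp.continuous_toLp 2 _).comp
      (continuous_fst.matrix_transpose.matrix_mulVec
        ((PiLp.continuous_ofLp 2 _).comp continuous_snd))
  exact h1.measurable.comp (measurable_snd.prodMk (hφ.comp measurable_fst))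

lemma measurable_factorStep {n : ℕ} {φ : ℝ → EuclideanSpace ℝ (Fin n)} (hφ : Measurable φ)
    {σ : ℝ} (hσ : 0 < σ) : Measurable (Function.uncurry (factorStep φ σ)) := by
  have hv : Measurable fun p : (ℝ × Matrix (Fin n) (Fin n) ℝ) × ℝ => whitenedRegressor φ p.1 :=
    (measurable_whitenedRegressor hφ).comp measurable_fst
  have hs : Measurable (innovScale σ : EuclideanSpace ℝ (Fin n) → ℝ) :=
    (continuous_innovScale σ).measurable
  have h1 : Continuous fun p : Matrix (Fin n) (Fin n) ℝ × EuclideanSpace ℝ (Fin n) =>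
      p.1 - rankOneCoeff σ p.2 • (p.1 * Matrix.vecMulVec p.2.ofLp p.2.ofLp) := by
    have h2 := (PiLp.continuous_ofLp 2 fun _ : Fin n => ℝ).comp
      (continuous_snd (X := Matrix (Fin n) (Fin n) ℝ) (Y := EuclideanSpace ℝ (Fin n)))
    exact continuous_fst.sub (((continuous_rankOneCoeff hσ).comp continuous_snd).smul
      (continuous_fst.mul (h2.matrix_vecMulVec h2)))
  exact ((hs.comp hv).mul measurable_snd).prodMk
    (h1.measurable.comp ((measurable_snd.comp measurable_fst).prodMk hv))

/-- What is known before the noise `w_{t+1}` is the initial output, the parameter and the first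
`t` noises; these are recorded by a sequence padded with zeros. -/
lemma isInnovationSystem_factorLoop {n : ℕ} {φ : ℝ → EuclideanSpace ℝ (Fin n)}
    (hφ : Measurable φ) [IsProbabilityMeasure μ] {σ : ℝ} (hσ : 0 < σ)
    {θ0 : EuclideanSpace ℝ (Fin n)} {θ : Ω → EuclideanSpace ℝ (Fin n)} {w : ℕ → Ω → ℝ}
    {y0 : Ω → ℝ} (hθ : Measurable θ) (hw : ∀ t, Measurable (w t)) (hy0 : Measurable y0)
    (hw_law : ∀ t, μ.map (w (t + 1)) = gaussianReal 0 (Real.toNNReal (σ ^ 2)))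
    (hw_indep : iIndepFun (fun t => w (t + 1)) μ)
    (hθ_law : μ.map θ = multivariateGaussian θ0 1)
    (hθ_indep : IndepFun θ (fun ω t => w (t + 1) ω) μ)
    (hy0_indep : IndepFun y0 (fun ω => (θ ω, fun t => w (t + 1) ω)) μ) :
    IsInnovationSystem μ (stdGaussian (EuclideanSpace ℝ (Fin n))) (gaussianReal 0 1)
      (fun t => MeasurableSpace.comap
        (fun ω => (y0 ω, (θ ω, fun i : ℕ => if i < t then w (i + 1) ω else 0))) inferInstance)
      (fun _ => factorStep φ σ) (fun S => innovRotation σ (whitenedRegressor φ S))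
      (fun t ω => (factorLoop φ σ θ0 (θ ω) (y0 ω) (fun s => w s ω) t).1)
      (fun t ω => (factorLoop φ σ θ0 (θ ω) (y0 ω) (fun s => w s ω) t).2)
      (fun t ω => w (t + 1) ω / σ)
      (fun t ω => (innovRotation σ (whitenedRegressor φ
        (factorLoop φ σ θ0 (θ ω) (y0 ω) (fun s => w s ω) t).1)
        ((factorLoop φ σ θ0 (θ ω) (y0 ω) (fun s => w s ω) t).2, w (t + 1) ω / σ)).2) := by
  have hpast : ∀ t : ℕ, Measurable fun (f : ℕ → ℝ) (i : ℕ) => if i < t then f i else 0 := by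
    intro t
    refine measurable_pi_lambda _ fun i => ?_
    split_ifs <;> fun_prop
  have hW : Measurable fun ω (t : ℕ) => w (t + 1) ω := measurable_pi_lambda _ fun t => hw (t + 1)
  have hpastW : ∀ t : ℕ, Measurable fun ω (i : ℕ) => if i < t then w (i + 1) ω else 0 :=
    fun t => (hpast t).comp hW
  have hknown : ∀ t, Measurable[MeasurableSpace.comap
      (fun ω => (y0 ω, (θ ω, fun i : ℕ => if i < t then w (i + 1) ω else 0))) inferInstance]
      (fun ω => (y0 ω, (θ ω, fun i : ℕ => if i < t then w (i + 1) ω else 0))) :=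
    fun t => comap_measurable _
  refine
    { measurable_F := fun _ => measurable_factorStep hφ hσ
      measurable_R := ?_
      map_R := fun S => map_innovRotation hσ _
      le := fun t => (hy0.prodMk (hθ.prodMk (hpastW t))).comap_le
      mono := ?_
      measurable_S_zero := ?_
      measurable_z_zero := ?_
      measurable_noise := ?_
      indep_noise := ?_
      map_noise := ?_
      indep_zero := ?_
      map_z_zero := ?_
      rotate := fun t ω => rfl
      step := fun t ω => rfl }
  · exact (continuous_innovRotation hσ).measurable.comp
      (((measurable_whitenedRegressor hφ).comp measurable_fst).prodMk measurable_snd)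
  · intro t
    rw [← measurable_iff_comap_le]
    have h1 : Measurable fun p : ℝ × EuclideanSpace ℝ (Fin n) × (ℕ → ℝ) =>
        (p.1, (p.2.1, fun i : ℕ => if i < t then p.2.2 i else 0)) :=
      measurable_fst.prodMk ((measurable_fst.comp measurable_snd).prodMk
        ((hpast t).comp (measurable_snd.comp measurable_snd)))
    convert h1.comp (hknown (t + 1)) using 1
    funext ω
    simp only [Function.comp, Prod.mk.injEq, true_and]
    funext i
    by_cases hi : i < t
    · simp [hi, Nat.lt_succ_of_lt hi]
    · simp [hi]
  · have h1 : Measurable fun p : ℝ × EuclideanSpace ℝ (Fin n) × (ℕ → ℝ) =>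
        (p.1, (1 : Matrix (Fin n) (Fin n) ℝ)) := by fun_prop
    exact h1.comp (hknown 0)
  · have h1 : Measurable fun p : ℝ × EuclideanSpace ℝ (Fin n) × (ℕ → ℝ) => p.2.1 - θ0 := by
      fun_prop
    exact h1.comp (hknown 0)
  · intro t
    have h1 : Measurable fun p : ℝ × EuclideanSpace ℝ (Fin n) × (ℕ → ℝ) => p.2.2 t / σ := by
      fun_prop
    simpa [Function.comp_def] using h1.comp (hknown (t + 1))
  · intro t
    rw [← IndepFun_iff_Indep]
    have h1 : IndepFun (fun ω (i : ℕ) => if i < t then w (i + 1) ω else 0) (w (t + 1)) μ := by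
      have h2 := hw_indep.indepFun_finset (Finset.range t) {t} (by simp) (fun i => hw (i + 1))
      have h3 : Measurable fun (f : Finset.range t → ℝ) (i : ℕ) =>
          if hi : i ∈ Finset.range t then f ⟨i, hi⟩ else 0 := by
        refine measurable_pi_lambda _ fun i => ?_
        split_ifs <;> fun_prop
      have h4 : Measurable fun f : ({t} : Finset ℕ) → ℝ => f ⟨t, by simp⟩ := by fun_prop
      have h5 := h2.comp h3 h4
      have h6 : (fun ω (i : ℕ) => if i < t then w (i + 1) ω else 0) =
          (fun (f : Finset.range t → ℝ) (i : ℕ) =>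
            if hi : i ∈ Finset.range t then f ⟨i, hi⟩ else 0) ∘
              fun ω (i : Finset.range t) => w (i + 1) ω := by
        funext ω i
        simp
      rw [h6]
      exact h5
    have h2 : IndepFun (fun ω => (θ ω, fun i : ℕ => if i < t then w (i + 1) ω else 0))
        (w (t + 1)) μ :=
      indepFun_prodMk_left_of_indepFun_prodMk_right hθ (hpastW t) (hw _)
        (hθ_indep.comp (φ := id)
          (ψ := fun f : ℕ → ℝ => ((fun i : ℕ => if i < t then f i else 0), f t)) measurable_id
          ((hpast t).prodMk (by fun_prop))) h1
    have h3 : IndepFun (fun ω => (y0 ω, (θ ω, fun i : ℕ => if i < t then w (i + 1) ω else 0)))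
        (w (t + 1)) μ :=
      indepFun_prodMk_left_of_indepFun_prodMk_right hy0 (hθ.prodMk (hpastW t)) (hw _)
        (hy0_indep.comp (φ := id)
          (ψ := fun p : EuclideanSpace ℝ (Fin n) × (ℕ → ℝ) =>
            ((p.1, fun i : ℕ => if i < t then p.2 i else 0), p.2 t)) measurable_id
          ((measurable_fst.prodMk ((hpast t).comp measurable_snd)).prodMk (by fun_prop))) h2
    exact h3.comp (φ := id) (ψ := fun x => x / σ) measurable_id (by fun_prop)
  · intro t
    have h1 : μ.map (fun ω => w (t + 1) ω / σ) = (μ.map (w (t + 1))).map (fun x => x / σ) := by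
      rw [Measure.map_map (by fun_prop) (hw _)]
      rfl
    rw [h1, hw_law, gaussianReal_map_div_const]
    congr 1
    · simp
    · ext
      simp [sq_nonneg, hσ.ne']
  · have h1 : IndepFun y0 θ μ :=
      hy0_indep.comp (φ := id) (ψ := Prod.fst) measurable_id measurable_fst
    exact h1.comp (φ := fun y => (y, (1 : Matrix (Fin n) (Fin n) ℝ))) (ψ := fun x => x - θ0)
      (by fun_prop) (by fun_prop)
  · have h1 : μ.map (fun ω => θ ω - θ0) = (μ.map θ).map (fun x => x - θ0) := by
      rw [Measure.map_map (by fun_prop) hθ]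
      rfl
    change μ.map (fun ω => θ ω - θ0) = _
    rw [h1, hθ_law, multivariateGaussian, Measure.map_map (by fun_prop) (by fun_prop)]
    simp [Function.comp_def]

end ClosedLoop

/-! ### Asymptotics of the closed loop -/

lemma sum_Icc_one_eq_sum_range_succ (f : ℕ → ℝ) (t : ℕ) :
    ∑ i ∈ Finset.Icc 1 t, f i = ∑ i ∈ Finset.range t, f (i + 1) := by
  induction t with
  | zero => simp
  | succ t ih => rw [Finset.sum_Icc_succ_top (by omega), ih, Finset.sum_range_succ]

theorem mainTheorem6
    {n : ℕ} (hn : 2 ≤ n)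
    -- the known vector function and the open set on which it is smooth
    (φ : ℝ → EuclideanSpace ℝ (Fin n)) (hφ : Measurable φ)
    (E : Set ℝ) (hE : IsOpen E) (hsmooth : ∀ j, ContDiffOn ℝ n (fun x => φ x j) E)
    (hlin : LinearIndependent ℝ (fun (j : Fin n) (x : E) => φ x j))
    -- the growth condition
    (b : ℝ) (hb : 0 < b) (hgrowth : ∃ K₁ K₂ : ℝ, ∀ x : ℝ, ‖φ x‖ ≤ K₁ + K₂ * |x| ^ b)
    -- the random parameter, noise and initial output
    {Ω : Type*} [MeasurableSpace Ω] (μ : Measure Ω) [IsProbabilityMeasure μ]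
    (σ : ℝ) (hσ : 0 < σ) (θ0 : EuclideanSpace ℝ (Fin n))
    (θ : Ω → EuclideanSpace ℝ (Fin n)) (w : ℕ → Ω → ℝ) (y0 : Ω → ℝ)
    (hθ : Measurable θ) (hw : ∀ t, Measurable (w t)) (hy0 : Measurable y0)
    (hw_law : ∀ t, μ.map (w (t + 1)) = gaussianReal 0 (Real.toNNReal (σ ^ 2)))
    (hw_indep : iIndepFun (fun t => w (t + 1)) μ)
    (hθ_law : μ.map θ = multivariateGaussian θ0 1)
    (hθ_indep : IndepFun θ (fun ω t => w (t + 1) ω) μ)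
    (hy0_indep : IndepFun y0 (fun ω => (θ ω, fun t => w (t + 1) ω)) μ)
    -- the closed-loop output, estimate and matrix
    (y : ℕ → Ω → ℝ) (est : ℕ → Ω → EuclideanSpace ℝ (Fin n))
    (P : ℕ → Ω → Matrix (Fin n) (Fin n) ℝ)
    (hy : ∀ t ω, y t ω = (closedLoop φ σ θ0 (θ ω) (y0 ω) (fun s => w s ω) t).y)
    (hest : ∀ t ω, est t ω = (closedLoop φ σ θ0 (θ ω) (y0 ω) (fun s => w s ω) t).est)
    (hP : ∀ t ω, P t ω = (closedLoop φ σ θ0 (θ ω) (y0 ω) (fun s => w s ω) t).P) :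
    (∃ D : Set Ω, MeasurableSet D ∧ μ D = 0 ∧
      {ω | (fun t : ℕ => ∑ i ∈ Finset.Icc 1 t, (y i ω) ^ 2) =O[atTop] (fun t : ℕ => (t : ℝ))} \ D ⊆
        {ω | 0 < liminf (fun t : ℕ => ((minEigenvalue (P (t + 1) ω)⁻¹ / t : ℝ) : EReal)) atTop} ∩
        {ω | Tendsto (fun t : ℕ => (1 / t : ℝ) * ∑ i ∈ Finset.Icc 1 t, (y i ω) ^ 2) atTop
          (𝓝 (σ ^ 2))}) ∧
    (∀ᵐ ω ∂μ,
      (fun t : ℕ => ∑ i ∈ Finset.Icc 1 t, (y i ω) ^ 2) =O[atTop] (fun t : ℕ => (t : ℝ)) →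
        (fun t : ℕ => ‖est (t + 1) ω - θ ω‖ ^ 2) =O[atTop]
          (fun t : ℕ => Real.log t / t)) := by
  classical
  have : NeZero n := ⟨by omega⟩
  set γ := stdGaussian (EuclideanSpace ℝ (Fin n))
  have hsys := isInnovationSystem_factorLoop hφ hσ hθ hw hy0 hw_law hw_indep hθ_law hθ_indep
    hy0_indep
  set S : ℕ → Ω → ℝ × Matrix (Fin n) (Fin n) ℝ :=
    fun t ω => (factorLoop φ σ θ0 (θ ω) (y0 ω) (fun s => w s ω) t).1
  set z : ℕ → Ω → EuclideanSpace ℝ (Fin n) :=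
    fun t ω => (factorLoop φ σ θ0 (θ ω) (y0 ω) (fun s => w s ω) t).2
  set e : ℕ → Ω → ℝ := fun t ω => (innovRotation σ (whitenedRegressor φ
    (factorLoop φ σ θ0 (θ ω) (y0 ω) (fun s => w s ω) t).1)
    ((factorLoop φ σ θ0 (θ ω) (y0 ω) (fun s => w s ω) t).2, w (t + 1) ω / σ)).2
  set scale : ℝ × Matrix (Fin n) (Fin n) ℝ → ℝ :=
    fun q => innovScale σ (whitenedRegressor φ q) with hscale
  have hscale_meas : Measurable scale :=
    (continuous_innovScale σ).measurable.comp (measurable_whitenedRegressor hφ)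
  have hystep : ∀ t ω, y (t + 1) ω = scale (S t ω) * e t ω := fun t ω => by
    rw [hy, closedLoop_eq_factorLoop φ hσ]
    rfl
  have hyS : ∀ t ω, y t ω = (S t ω).1 := fun t ω => by
    rw [hy, closedLoop_eq_factorLoop φ hσ]
  have hPS : ∀ t ω, P t ω = (S t ω).2 * (S t ω).2ᵀ := fun t ω => by
    rw [hP, closedLoop_eq_factorLoop φ hσ]
  have hestS : ∀ t ω, est t ω - θ ω = -WithLp.toLp 2 ((S t ω).2 *ᵥ (z t ω).ofLp) := fun t ω => by
    rw [hest, closedLoop_eq_factorLoop φ hσ]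
    simp [S, z]
  have hinfo : ∀ t ω, infoMatrix φ σ (fun i => y i ω) t * P t ω = 1 := fun t ω => by
    simp only [hy, hP]
    exact infoMatrix_mul_P φ hσ _ _ _ _ t
  clear_value S z e
  obtain ⟨I, hIlt, δ, hδ, hI⟩ := exists_finset_Ioo_le_abs_inner hE
    (fun j => (hsmooth j).continuousOn) hlin
  obtain ⟨K₁, K₂, hgrowth⟩ := hgrowth
  -- the almost sure properties of the innovations
  obtain ⟨p, hp, hp1⟩ := exists_pos_le_gaussianReal_mul_mem_Ioo (σ := 1) (M := 1) (a := 1) (b := 2)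
    one_pos (by norm_num)
  -- a scale above `M` produces, with positive probability, an output above `M`
  have hbig : ∀ᵐ ω ∂μ, ∀ M : ℕ, ∀ᶠ t : ℕ in atTop,
      p / 2 * ((Finset.range t).filter fun i => (M : ℝ) < scale (S i ω)).card ≤
        ((Finset.range t).filter fun i =>
          (M : ℝ) < scale (S i ω) ∧ e i ω ∈ Ioo (1 : ℝ) 2).card + 2 * Real.log (t + 1) := by
    refine ae_all_iff.2 fun M => ?_
    have h1 := hsys.ae_eventually_card_le (K := {q | (M : ℝ) < scale q})
      (measurableSet_lt measurable_const hscale_meas) (H := {q | q.2 ∈ Ioo (1 : ℝ) 2})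
      (measurable_snd measurableSet_Ioo) hp.le
      (fun s _ => by simpa using hp1 1 le_rfl le_rfl)
    filter_upwards [h1] with ω hω
    filter_upwards [hω] with t ht
    convert ht
  -- a scale below `M` lets the output reach each detecting interval
  have hhit : ∀ᵐ ω ∂μ, ∀ M : ℕ, ∀ q ∈ I, ∃ p : ℝ, 0 < p ∧ ∀ᶠ t : ℕ in atTop,
      p / 2 * ((Finset.range t).filter fun i => scale (S i ω) ≤ (M : ℝ)).card ≤
        ((Finset.range t).filter fun i =>
          scale (S i ω) ≤ (M : ℝ) ∧ y (i + 1) ω ∈ Ioo q.1 q.2).card + 2 * Real.log (t + 1) := by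
    refine ae_all_iff.2 fun M => (Finset.eventually_all I).2 fun q hq => ?_
    obtain ⟨p', hp', hp2⟩ := exists_pos_le_gaussianReal_mul_mem_Ioo (M := M) hσ (hIlt q hq)
    have h1 := hsys.ae_eventually_card_le (K := {r | scale r ≤ (M : ℝ)})
      (measurableSet_le hscale_meas measurable_const)
      (H := {r | scale r.1 * r.2 ∈ Ioo q.1 q.2})
      (((hscale_meas.comp measurable_fst).mul measurable_snd) measurableSet_Ioo) hp'.le
      (fun s hs => hp2 (scale s) (le_innovScale σ (whitenedRegressor φ s)) hs)
    filter_upwards [h1] with ω hω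
    refine ⟨p', hp', ?_⟩
    filter_upwards [hω] with t ht
    simp only [hystep]
    convert ht
  obtain ⟨Ke, hKe, hgrow_e⟩ := exists_ae_eventually_norm_sq_le_log (μ := μ) (gaussianReal 0 1)
  obtain ⟨Kz, hKz, hgrow_z⟩ := exists_ae_eventually_norm_sq_le_log (μ := μ) γ
  have hmean : ∀ᵐ ω ∂μ, Tendsto (fun t : ℕ => (∑ i ∈ Finset.range t, e i ω ^ 2) / t) atTop
      (𝓝 1) := by
    have hmom : ∫ x, x ^ 2 ∂(gaussianReal 0 1) = 1 := by
      have h1 := variance_fun_id_gaussianReal (μ := 0) (v := 1)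
      rw [variance_of_integral_eq_zero (by fun_prop) (by simp)] at h1
      simpa using h1
    have hid : ∀ i, IdentDistrib (e i) (e 0) μ μ := fun i =>
      ⟨(hsys.measurable_e i).aemeasurable, (hsys.measurable_e 0).aemeasurable, by
        rw [hsys.map_e, hsys.map_e]⟩
    have hint : Integrable (fun ω => e 0 ω ^ 2) μ := by
      have h1 : Integrable (fun x : ℝ => x ^ 2) (μ.map (e 0)) := by
        rw [hsys.map_e]
        exact (memLp_id_gaussianReal 2).integrable_sq
      exact h1.comp_measurable (hsys.measurable_e 0)
    have h1 := strong_law_ae_real (fun i ω => e i ω ^ 2) hint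
      (fun i j hij => (hsys.pairwise_indepFun hij).comp (φ := fun x => x ^ 2)
        (ψ := fun x => x ^ 2) (by fun_prop) (by fun_prop))
      (fun i => (hid i).comp (u := fun x => x ^ 2) (by fun_prop))
    have h2 : ∫ ω, e 0 ω ^ 2 ∂μ = 1 := by
      rw [← hmom, ← hsys.map_e 0, integral_map (hsys.measurable_e 0).aemeasurable (by fun_prop)]
    simpa only [h2] using h1
  have hall : ∀ᵐ ω ∂μ,
      (fun t : ℕ => ∑ i ∈ Finset.Icc 1 t, (y i ω) ^ 2) =O[atTop] (fun t : ℕ => (t : ℝ)) →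
        0 < liminf (fun t : ℕ => ((minEigenvalue (P (t + 1) ω)⁻¹ / t : ℝ) : EReal)) atTop ∧
        Tendsto (fun t : ℕ => (1 / t : ℝ) * ∑ i ∈ Finset.Icc 1 t, (y i ω) ^ 2) atTop
          (𝓝 (σ ^ 2)) ∧
        (fun t : ℕ => ‖est (t + 1) ω - θ ω‖ ^ 2) =O[atTop] (fun t : ℕ => Real.log t / t) := by
    filter_upwards [hbig, hhit, hgrow_e e hsys.measurable_e hsys.map_e,
      hgrow_z z hsys.measurable_z hsys.map_z, hmean] with ω h1 h2 h3 h4 h5 hO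
    obtain ⟨C, hC⟩ := hO.bound
    have hC' : ∀ᶠ t : ℕ in atTop,
        ∑ i ∈ Finset.range t, (scale (S i ω) * e i ω) ^ 2 ≤ C * t := by
      filter_upwards [hC] with t ht
      rw [sum_Icc_one_eq_sum_range_succ] at ht
      simp only [hystep, Real.norm_eq_abs, Nat.abs_cast] at ht
      exact (le_abs_self _).trans ht
    obtain ⟨M, hM⟩ := exists_eventually_half_le_card hp h1 hC'
    obtain ⟨c, hc, hlow⟩ := exists_eventually_le_infoMatrix hσ (y := fun i => y i ω)
      (s := fun i => scale (S i ω)) hδ hI (h2 M) hM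
    have hfactor : ∀ᶠ t : ℕ in atTop, ∀ u : EuclideanSpace ℝ (Fin n),
        c * t * ‖WithLp.toLp 2 ((S t ω).2 *ᵥ u.ofLp)‖ ^ 2 ≤ ‖u‖ ^ 2 ∧
          c * t * ‖WithLp.toLp 2 ((S t ω).2ᵀ *ᵥ u.ofLp)‖ ^ 2 ≤ ‖u‖ ^ 2 := by
      filter_upwards [hlow] with t ht u
      exact mul_norm_sq_le_of_mul_factor_eq_one (by rw [← hPS]; exact hinfo t ω)
        (by positivity) ht u
    refine ⟨?_, ?_, ?_⟩
    · refine lt_of_lt_of_le (EReal.coe_pos.2 hc) (le_liminf_of_le (by isBoundedDefault) ?_)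
      filter_upwards [(tendsto_add_atTop_nat 1).eventually hlow, eventually_gt_atTop 0]
        with t ht ht0
      have ht0' : (0 : ℝ) < t := by exact_mod_cast ht0
      rw [Matrix.inv_eq_left_inv (hinfo (t + 1) ω), EReal.coe_le_coe_iff, le_div_iff₀ ht0']
      refine le_trans ?_ (le_minEigenvalue (isHermitian_infoMatrix _ _ _ _) ht)
      push_cast
      nlinarith
    · -- the scales are below `M` half of the time, hence at arbitrarily late times
      have hfreq : ∃ᶠ t : ℕ in atTop, scale (S t ω) ^ 2 ≤ (M : ℝ) ^ 2 := by
        intro hcon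
        obtain ⟨T, hT⟩ := eventually_atTop.1 hcon
        obtain ⟨t, ht, htT⟩ := (hM.and (eventually_gt_atTop (2 * T))).exists
        have hcard : ((Finset.range t).filter fun i => scale (S i ω) ≤ (M : ℝ)).card ≤ T := by
          rw [← Finset.card_range T]
          refine Finset.card_le_card fun i hi => ?_
          rw [Finset.mem_range]
          by_contra! hiT
          exact hT i hiT (pow_le_pow_left₀ (innovScale_pos hσ _).le (Finset.mem_filter.1 hi).2 2)
        have hcard' : (((Finset.range t).filter fun i => scale (S i ω) ≤ (M : ℝ)).card : ℝ) ≤ T :=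
          by exact_mod_cast hcard
        have htT' : (2 : ℝ) * T < t := by exact_mod_cast htT
        linarith
      have hlim := tendsto_scale_sq (y := fun t => y t ω) (s := fun t => scale (S t ω))
        (e := fun t => e t ω) hb hgrowth hc hKe (fun t => hystep t ω)
        (fun t => by
          simp only [hscale, innovScale_sq]
          exact le_add_of_nonneg_right (sq_nonneg _))
        (by
          filter_upwards [hfactor] with t ht
          simp only [hscale, innovScale_sq, add_sub_cancel_left]
          rw [hyS]
          exact (ht _).2)
        (by simpa [sq_abs] using h3) hfreq
      have hlim2 := tendsto_weighted_mean (fun i => sq_nonneg (e i ω)) h5 hlim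
      refine hlim2.congr fun t => ?_
      rw [sum_Icc_one_eq_sum_range_succ, one_div, inv_mul_eq_div]
      simp only [hystep, mul_pow]
    · refine isBigO_log_div_of_eventually_le (f := fun t => ‖est t ω - θ ω‖ ^ 2)
        (fun t => sq_nonneg _) hc hKz ?_
      filter_upwards [hfactor, h4] with t ht ht4
      rw [hestS, norm_neg]
      exact (ht _).1.trans ht4
  refine ⟨?_, hall.mono fun ω hω hO => (hω hO).2.2⟩
  obtain ⟨D, hD, hDm, hD0⟩ := exists_measurable_superset_of_null (ae_iff.1 hall)
  refine ⟨D, hDm, hD0, fun ω hω => ?_⟩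
  have h1 := not_not.1 fun hn => hω.2 (hD hn)
  exact ⟨(h1 hω.1).1, (h1 hω.1).2.1⟩
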